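/- Let $n,m\ge 0$ be integers, $f:\{0,1\}^n\to\mathbb R$, $H:\{0,1\}^n\to\mathbb R^m$, $b\in\mathbb R^m$, $M>0$, $S=[-M,M]^m$, and $L(x,\lambda)=f(x)+\lambda^T(H(x)-b)$ for $x\in\{0,1\}^n$, $\lambda\in\mathbb R^m$. Write a point $v\in\mathbb R^{m+1}$ as $(\lambda_v,z_v)$ with $\lambda_v\in\mathbb R^m$, $z_v\in\mathbb R$. For $x\in\{0,1\}^n$ let $P_x=\{(\lambda,z): z=L(x,\lambda)\}$ and $P_x(\lambda)=L(x,\lambda)$. For nonempty $X\subseteq\{0,1\}^n$ let $g_X(\lambda)=\min_{x\in X}L(x,\lambda)$ and $\Gamma_X=\{q\in\mathbb R^{m+1}:\lambda_q\in S,\ z_q\le g_X(\lambda_q)\}$. A point $y$ is a proper convex combination of a finite set $W=\{w_1,\dots,w_k\}$ if $y=\sum_i\alpha_iw_i$ with all $\alpha_i\in(0,1)$ and $\sum_i\alpha_i=1$. A vertex of a set $K\subseteq\mathbb R^{m+1}$ is a point $v\in K$ such that whenever $v$ is a proper convex combination of $U\subseteq K$, then $U=\{v\}$. A bounded edge of $K$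 is a segment $e(u,v)$ between two distinct vertices $u,v$ of $K$ such that whenever some $y\in e(u,v)$ is a proper convex combination of $W\subseteq K$, then $W\subseteq e(u,v)$. The vertical ray below $u$ is regarded as the edge $e(u,(\lambda_u,-\infty))$ joining $u$ to $(\lambda_u,-\infty)$. The skeleton $\mathcal G_{g_X}=(\mathcal V_{g_X},\mathcal E_{g_X})$ of $g_X$ over $S$ consists of the set $\mathcal V_{g_X}$ of all vertices of $\Gamma_X$, and the set $\mathcal E_{g_X}$ of all bounded edges of $\Gamma_X$ together with the vertical rays below those vertices $u\in\mathcal V_{g_X}$ with $\lambda_u\in\{-M,M\}^m$. The algorithm DualSearch maintains a set $X\subseteq\{0,1\}^n$ and a graph $\mathcal G=(\mathcal V,\mathcal E)$ as follows. An oracle call for $\lambda$ returns an arbitrary element of $\operatorname{argmin}_{x\in\{0,1\}^n}L(x,\lambda)$. Initialization: $X=\{x_0\}$, where $x_0$ is returned by the oracle for an arbitrary $\lambda_0\in\{-M,M\}^m$; $\mathcal V=\{(\lambda,P_{x_0}(\lambda)):\lambda\in\{-M,M\}^m\}$; $\mathcal E=\mathcal E_{g_X}$. Iteration: an arbitrary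 vertex $v\in\mathcal V$ that has not been chosen before is chosen, and the oracle returns $x_v$ for $\lambda_v$. If $P_{x_v}(\lambda_v)\ge z_v$, nothing changes. If $P_{x_v}(\lambda_v)<z_v$, let $$\mathcal V^+=\{u\in P_{x_v}\cap e: e\in\mathcal E,\ e\not\subseteq P_{x_v}\},\qquad \mathcal V^-=\{u\in\mathcal V: z_u>P_{x_v}(\lambda_u)\},$$ let $\mathcal E^-$ be the set of all edges in $\mathcal E$ with an endpoint in $\mathcal V^-$, let $\mathcal E^+$ be the set of all $e(u_1,u_3)$ with $u_3\ne u_1$ such that there is $e(u_1,u_2)\in\mathcal E^-$ with $u_1\notin\mathcal V^-$ (possibly $u_1=(\lambda_{u_2},-\infty)$) and $e(u_1,u_2)\cap P_{x_v}=\{u_3\}$, and let $ConvEdge(\mathcal V^+)$ be the set of bounded edges of the convex hull of $\mathcal V^+$. Then $X$ is replaced by $X\cup\{x_v\}$, $\mathcal V$ by $(\mathcal V\cup\mathcal V^+)\setminus\mathcal V^-$, and $\mathcal E$ by $(\mathcal E\cup ConvEdge(\mathcal V^+)\cup\mathcal E^+)\setminus\mathcal E^-$. Claim: for every execution of DualSearch,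 after the initialization and at the end of every iteration, $\mathcal G=\mathcal G_{g_X}$, that is, $\mathcal V=\mathcal V_{g_X}$ and $\mathcal E=\mathcal E_{g_X}$ for the current set $X$. -/

import Mathlib

namespace DualSearch

/-- `L(x, lam) = f(x) + lam ⬝ (H(x) - b)`, for `x ∈ {0,1}^n` and `lam ∈ ℝ^m`. -/
noncomputable def lagrangian {n m : ℕ} (f : (Fin n → Bool) → ℝ)
    (H : (Fin n → Bool) → Fin m → ℝ) (b : Fin m → ℝ)
    (x : Fin n → Bool) (lam : Fin m → ℝ) : ℝ :=
  f x + ∑ i, lam i * (H x i - b i)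

/-- `O(lam) = argmin_x L(x, lam)`; an oracle call returns some element of this set. -/
def oracle {n m : ℕ} (L : (Fin n → Bool) → (Fin m → ℝ) → ℝ) (lam : Fin m → ℝ) :
    Set (Fin n → Bool) :=
  {x | ∀ y, L x lam ≤ L y lam}

/-- The induced dual `g_X(lam) = min_{x ∈ X} L(x, lam)`. -/
noncomputable def inducedDual {n m : ℕ} (L : (Fin n → Bool) → (Fin m → ℝ) → ℝ)
    (X : Set (Fin n → Bool)) (lam : Fin m → ℝ) : ℝ :=
  ⨅ x : X, L x lam

/-- For nonempty `X` the infimum in `inducedDual` is a minimum. -/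
theorem inducedDual_isLeast {n m : ℕ} (L : (Fin n → Bool) → (Fin m → ℝ) → ℝ)
    {X : Set (Fin n → Bool)} (hX : X.Nonempty) (lam : Fin m → ℝ) :
    IsLeast ((fun x => L x lam) '' X) (inducedDual L X lam) := by
  have : Nonempty X := hX.to_subtype
  obtain ⟨x, hx⟩ := exists_eq_ciInf_of_finite (f := fun x : X => L x lam)
  refine ⟨⟨x, x.2, hx⟩, ?_⟩
  rintro _ ⟨y, hy, rfl⟩
  exact ciInf_le (Set.finite_range fun x : X => L x lam).bddBelow ⟨y, hy⟩

/-- `P_x = {(lam, z) : z = L(x, lam)}`, a subset of `ℝ^m × ℝ`. -/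
def hyperplane {n m : ℕ} (L : (Fin n → Bool) → (Fin m → ℝ) → ℝ) (x : Fin n → Bool) :
    Set ((Fin m → ℝ) × ℝ) :=
  {q | q.2 = L x q.1}

/-- `y` is a proper convex combination of the points of `W = {w_1, …, w_k}`. -/
def IsProperConvexComb {m : ℕ} (y : (Fin m → ℝ) × ℝ) (W : Set ((Fin m → ℝ) × ℝ)) : Prop :=
  ∃ (k : ℕ) (w : Fin k → (Fin m → ℝ) × ℝ) (a : Fin k → ℝ),
    Set.range w = W ∧ (∀ i, a i ∈ Set.Ioo (0 : ℝ) 1) ∧ ∑ i, a i = 1 ∧ y = ∑ i, a i • w i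

/-- The points of `K` that are a proper convex combination only of themselves. -/
def vertices {m : ℕ} (K : Set ((Fin m → ℝ) × ℝ)) : Set ((Fin m → ℝ) × ℝ) :=
  {v | v ∈ K ∧ ∀ U ⊆ K, IsProperConvexComb v U → U = {v}}

/-- The bounded edges of `K`: the segments `e(u, v)` between distinct vertices `u, v` of `K`
such that whenever a point of `e(u, v)` is a proper convex combination of `W ⊆ K`, then
`W ⊆ e(u, v)`. -/
def boundedEdges {m : ℕ} (K : Set ((Fin m → ℝ) × ℝ)) : Set (Set ((Fin m → ℝ) × ℝ)) :=
  {e | ∃ u ∈ vertices K, ∃ v ∈ vertices K, u ≠ v ∧ e = segment ℝ u v ∧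
    ∀ y ∈ e, ∀ W ⊆ K, IsProperConvexComb y W → W ⊆ e}

/-- The vertical ray below `u`, that is, the edge joining `u` to `(lam_u, -∞)`. -/
def downRay {m : ℕ} (u : (Fin m → ℝ) × ℝ) : Set ((Fin m → ℝ) × ℝ) :=
  {q | q.1 = u.1 ∧ q.2 ≤ u.2}

/-- The box `S = [-M, M]^m`. -/
def box (m : ℕ) (M : ℝ) : Set (Fin m → ℝ) :=
  {lam | ∀ i, lam i ∈ Set.Icc (-M) M}

/-- The corners `{-M, M}^m` of the box. -/
def corners (m : ℕ) (M : ℝ) : Set (Fin m → ℝ) :=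
  {lam | ∀ i, lam i = -M ∨ lam i = M}

/-- `Γ(S) = {q : lam_q ∈ S, z_q ≤ g(lam_q)}`, the part below the graph of `g` over `S`. -/
def hypograph {m : ℕ} (M : ℝ) (g : (Fin m → ℝ) → ℝ) : Set ((Fin m → ℝ) × ℝ) :=
  {q | q.1 ∈ box m M ∧ q.2 ≤ g q.1}

/-- The skeleton of `g` over `S = [-M, M]^m`, as the pair (vertex set, edge set): an edge is a
bounded edge of the region below `g`, or the vertical ray below a vertex over a corner. -/
def skeleton {m : ℕ} (M : ℝ) (g : (Fin m → ℝ) → ℝ) :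
    Set ((Fin m → ℝ) × ℝ) × Set (Set ((Fin m → ℝ) × ℝ)) :=
  (vertices (hypograph M g),
   boundedEdges (hypograph M g) ∪
    {e | ∃ u ∈ vertices (hypograph M g), u.1 ∈ corners m M ∧ e = downRay u})

/-- The edges of the convex hull of a set of points. -/
def convEdge {m : ℕ} (A : Set ((Fin m → ℝ) × ℝ)) : Set (Set ((Fin m → ℝ) × ℝ)) :=
  boundedEdges (convexHull ℝ A)

/-- `V⁺`: the intersection points of the hyperplane `P` with the edges not contained in `P`. -/
def addedVertices {m : ℕ} (E : Set (Set ((Fin m → ℝ) × ℝ))) (P : Set ((Fin m → ℝ) × ℝ)) :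
    Set ((Fin m → ℝ) × ℝ) :=
  {u | ∃ e ∈ E, ¬ e ⊆ P ∧ u ∈ P ∩ e}

/-- `V⁻`: the vertices strictly above the hyperplane `z = ℓ(lam)`. -/
def removedVertices {m : ℕ} (V : Set ((Fin m → ℝ) × ℝ)) (ℓ : (Fin m → ℝ) → ℝ) :
    Set ((Fin m → ℝ) × ℝ) :=
  {u | u ∈ V ∧ ℓ u.1 < u.2}

/-- `E⁻`: the edges with an endpoint in `V⁻` (`Vminus` below). -/
def removedEdges {m : ℕ} (E : Set (Set ((Fin m → ℝ) × ℝ))) (Vminus : Set ((Fin m → ℝ) × ℝ)) :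
    Set (Set ((Fin m → ℝ) × ℝ)) :=
  {e | e ∈ E ∧ ∃ u ∈ Vminus, (∃ w, e = segment ℝ w u) ∨ e = downRay u}

/-- `E⁺`: for every removed edge `e(u₁, u₂)` that meets the hyperplane `P` in a single point
`u₃`, the part `e(u₁, u₃)`, where `u₁` is the endpoint which is not removed, possibly the
endpoint `(lam, -∞)` of a vertical ray. Degenerate segments `u₃ = u₁` do not count as edges. -/
def addedEdges {m : ℕ} (Eminus : Set (Set ((Fin m → ℝ) × ℝ)))
    (Vminus P : Set ((Fin m → ℝ) × ℝ)) : Set (Set ((Fin m → ℝ) × ℝ)) :=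
  {e | ∃ u₁ u₂ u₃, u₁ ∉ Vminus ∧ segment ℝ u₁ u₂ ∈ Eminus ∧ segment ℝ u₁ u₂ ∩ P = {u₃} ∧
      u₃ ≠ u₁ ∧ e = segment ℝ u₁ u₃} ∪
  {e | ∃ u₂ u₃, downRay u₂ ∈ Eminus ∧ downRay u₂ ∩ P = {u₃} ∧ e = downRay u₃}

/-- The data maintained by the algorithm: the minimizers `X` found so far, the graph `(V, E)`,
and the set of vertices that the loop has already gone through. -/
structure State (n m : ℕ) where
  X : Set (Fin n → Bool)
  V : Set ((Fin m → ℝ) × ℝ)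
  E : Set (Set ((Fin m → ℝ) × ℝ))
  processed : Set ((Fin m → ℝ) × ℝ)

/-- The initialization from an oracle answer `x₀`. -/
noncomputable def initState {n m : ℕ} (L : (Fin n → Bool) → (Fin m → ℝ) → ℝ) (M : ℝ)
    (x₀ : Fin n → Bool) : State n m where
  X := {x₀}
  V := {v | v.1 ∈ corners m M ∧ v.2 = L x₀ v.1}
  E := (skeleton M (inducedDual L {x₀})).2
  processed := ∅

/-- The update of the data by a new minimizer `x`: the graph is cut by the hyperplane `P_x`. -/
def cut {n m : ℕ} (L : (Fin n → Bool) → (Fin m → ℝ) → ℝ) (s : State n m)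
    (x : Fin n → Bool) : State n m :=
  let P := hyperplane L x
  let Vplus := addedVertices s.E P
  let Vminus := removedVertices s.V (L x)
  let Eminus := removedEdges s.E Vminus
  let Eplus := addedEdges Eminus Vminus P
  { X := s.X ∪ {x}
    V := (s.V ∪ Vplus) \ Vminus
    E := (s.E ∪ convEdge Vplus ∪ Eplus) \ Eminus
    processed := s.processed }

open Classical in
/-- The body of the loop for the vertex `v` and the oracle answer `x`. -/
noncomputable def iterate {n m : ℕ} (L : (Fin n → Bool) → (Fin m → ℝ) → ℝ) (s : State n m)
    (v : (Fin m → ℝ) × ℝ) (x : Fin n → Bool) : State n m :=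
  let s' := if L x v.1 < v.2 then cut L s x else s
  { s' with processed := s'.processed ∪ {v} }

/-- `ReachedAfter L M t s`: some execution of DualSearch is in state `s` after `t` iterations.
The order in which the loop goes through the vertices is arbitrary, also for the vertices that
are appended, so an iteration may take any vertex of the current graph not taken before. -/
inductive ReachedAfter {n m : ℕ} (L : (Fin n → Bool) → (Fin m → ℝ) → ℝ) (M : ℝ) :
    ℕ → State n m → Prop
  | init (lam₀ : Fin m → ℝ) (hlam₀ : lam₀ ∈ corners m M)
      (x₀ : Fin n → Bool) (hx₀ : x₀ ∈ oracle L lam₀) :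
      ReachedAfter L M 0 (initState L M x₀)
  | step (t : ℕ) (s : State n m) (hs : ReachedAfter L M t s)
      (v : (Fin m → ℝ) × ℝ) (hv : v ∈ s.V) (hv' : v ∉ s.processed)
      (x : Fin n → Bool) (hx : x ∈ oracle L v.1) :
      ReachedAfter L M (t + 1) (iterate L s v x)

end DualSearch

namespace DualSearch

open Set Filter Topology

/-! Adding a minimizer `x` to `X` intersects the region `K` below `g_X` with the half-space `ψ ≤ s`,
where `ψ = heightAbove (H x - b)` and `s = f x`. So the claim follows by induction from a statement
on how the vertices and edges of a polyhedron change under such a cut.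

The main tool is the space of free directions at a point of a polyhedron: the common kernel of the
tight constraints (`freeDirection_polyhedron`). Vertices are the points where it is zero, and a
point where it is a line lies on an edge (`line_mem_skeleton`). Strictly below the cutting
hyperplane the free directions are unaffected by the cut.

Hence a vertex of the cut region that is not a vertex of `K` lies on the hyperplane, and its free
directions in `K` form a line transversal to it: an edge of `K` crosses there. An old vertex on the
hyperplane has an edge leaving the hyperplane, because `K` also has points off it
(`exists_line_at_vertex`). So `V⁺` is exactly the vertex set of the slice `K ∩ {ψ = s}`
(`addedVertices_eq`). The slice is compact, hence the convex hull of `V⁺`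
(`convexHull_extremePoints_level`), and it is a face of the cut region: its edges are the new edges
inside the hyperplane. Any other new bounded edge has its midpoint strictly below the hyperplane, so
it is an edge of `K`, possibly trimmed (`segment_cut_mem`). Vertical rays are trimmed likewise,
since `ψ` has slope one along them. -/

theorem eq_of_convex_comb_eq {a b A B C : ℝ} (ha : 0 < a) (hb : 0 < b) (hab : a + b = 1)
    (hA : A ≤ C) (hB : B ≤ C) (h : a * A + b * B = C) : A = C := by
  have h1 : b * B ≤ b * C := mul_le_mul_of_nonneg_left hB hb.le
  have h2 : a * C + b * C = C := by rw [← add_mul, hab, one_mul]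
  exact le_antisymm hA (le_of_mul_le_mul_left (by linarith) ha)

/-! ### Free directions and faces of polyhedra -/

section Convex

variable {E : Type*} [AddCommGroup E] [Module ℝ E]

/-- `d` is a free direction of `K` at `y`: some segment around `y` in direction `d` is in `K`. -/
def FreeDirection (K : Set E) (y d : E) : Prop :=
  ∃ ε : ℝ, 0 < ε ∧ y + ε • d ∈ K ∧ y - ε • d ∈ K

theorem mem_openSegment_add_sub (y d : E) {ε δ : ℝ} (hε : 0 < ε) (hδ : 0 < δ) :
    y ∈ openSegment ℝ (y + ε • d) (y - δ • d) := by
  have h : ε + δ ≠ 0 := by positivity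
  refine ⟨δ / (ε + δ), ε / (ε + δ), by positivity, by positivity, by field_simp; ring, ?_⟩
  have h1 : δ / (ε + δ) + ε / (ε + δ) = 1 := by field_simp; ring
  have h2 : δ / (ε + δ) * ε - ε / (ε + δ) * δ = 0 := by ring
  calc _ = (δ / (ε + δ) + ε / (ε + δ)) • y
        + (δ / (ε + δ) * ε - ε / (ε + δ) * δ) • d := by module
    _ = y := by rw [h1, h2]; simp

/-- The point lies strictly between its two displacements, so extremality pulls both of them into
the face. -/
theorem FreeDirection.mem_extreme {K e : Set E} (he : IsExtreme ℝ K e) {y d : E}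
    (hy : y ∈ e) (h : FreeDirection K y d) : FreeDirection e y d := by
  obtain ⟨ε, hε, h1, h2⟩ := h
  have := mem_openSegment_add_sub y d hε hε
  exact ⟨ε, hε, he.2 h1 h2 hy this, he.right_mem_of_mem_openSegment h1 h2 hy this⟩

theorem freeDirection_of_mem_openSegment {K : Set E} (hK : Convex ℝ K) {y a b : E}
    (ha : a ∈ K) (hb : b ∈ K) (h : y ∈ openSegment ℝ a b) : FreeDirection K y (a - b) := by
  obtain ⟨s, t, hs, ht, hst, rfl⟩ := h
  -- Moving by `r • (a - b)` turns the weights `s, t` into `s + r, t - r`; with `|r| ≤ min s t` they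
  -- stay nonnegative.
  refine ⟨min s t, lt_min hs ht, ?_, ?_⟩
  · have := hK ha hb (a := s + min s t) (b := t - min s t) (by positivity)
      (by simp) (by linarith)
    convert this using 1
    module
  · have := hK ha hb (a := s - min s t) (b := t + min s t) (by simp)
      (by positivity) (by linarith)
    convert this using 1
    module

theorem mem_extremePoints_iff_freeDirection {K : Set E} (hK : Convex ℝ K) {y : E} :
    y ∈ K.extremePoints ℝ ↔ y ∈ K ∧ ∀ d, FreeDirection K y d → d = 0 := by
  constructor
  · rintro hy
    refine ⟨hy.1, fun d ⟨ε, hε, h1, h2⟩ => ?_⟩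
    have := hy.2 h1 h2 (mem_openSegment_add_sub y d hε hε)
    simpa [hε.ne'] using this
  · rintro ⟨hy, h⟩
    refine ⟨hy, fun a ha b hb hab => ?_⟩
    have h0 := sub_eq_zero.1 (h _ (freeDirection_of_mem_openSegment hK ha hb hab))
    subst h0
    simpa [eq_comm] using hab

theorem isExtreme_inter_level (K : Set E) (ψ : E →ₗ[ℝ] ℝ) (s : ℝ) (hK : ∀ q ∈ K, ψ q ≤ s) :
    IsExtreme ℝ K (K ∩ {q | ψ q = s}) := by
  refine ⟨inter_subset_left, ?_⟩
  rintro x hx y hy z ⟨-, hz⟩ ⟨a, b, ha, hb, hab, rfl⟩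
  simp only [mem_ofPred_eq, map_add, map_smul, smul_eq_mul] at hz
  exact ⟨hx, eq_of_convex_comb_eq ha hb hab (hK x hx) (hK y hy) hz⟩

theorem eq_or_eq_of_mem_segment {K : Set E} {u a b : E}
    (hu : u ∈ K.extremePoints ℝ) (hab : segment ℝ a b ⊆ K) (h : u ∈ segment ℝ a b) :
    u = a ∨ u = b := by
  rcases (mem_extremePoints_iff_forall_segment.1 hu).2 a (hab (left_mem_segment ℝ a b)) b
    (hab (right_mem_segment ℝ a b)) h with h | h
  · exact Or.inl h.symm
  · exact Or.inr h.symm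

theorem left_mem_extremePoints_segment (a b : E) : a ∈ (segment ℝ a b).extremePoints ℝ := by
  rcases eq_or_ne a b with rfl | hab
  · simp
  refine ⟨left_mem_segment ℝ a b, ?_⟩
  rw [segment_eq_image']
  rintro _ ⟨s, hs, rfl⟩ _ ⟨t, ht, rfl⟩ ⟨x, y, hx, hy, hxy, h⟩
  have h1 : (x * s + y * t) • (b - a) = 0 := by
    have : (x + y) • a + (x * s + y * t) • (b - a) = a := by
      refine Eq.trans ?_ h
      module
    rwa [hxy, one_smul, add_eq_left] at this
  have h2 : x * s + y * t = 0 := by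
    simpa [sub_eq_zero, hab.symm] using h1
  have h3 : s = 0 := by
    have := mul_nonneg hy.le ht.1
    have := mul_nonneg hx.le hs.1
    have : x * s = 0 := by linarith
    simpa [hx.ne'] using this
  simp [h3]

/-- A segment cut by a half-space that contains exactly one of its ends. -/
theorem segment_inter_halfspace {u₁ u₂ u₃ : E} (ψ : E →ₗ[ℝ] ℝ) {s : ℝ} (h1 : ψ u₁ < s)
    (h2 : s < ψ u₂) (h3 : u₃ ∈ segment ℝ u₁ u₂) (h3' : ψ u₃ = s) :
    segment ℝ u₁ u₂ ∩ {q | ψ q ≤ s} = segment ℝ u₁ u₃ := by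
  rw [segment_eq_image'] at h3
  obtain ⟨θ, ⟨hθ0, hθ1⟩, rfl⟩ := h3
  simp only [map_add, map_smul, map_sub, smul_eq_mul] at h3'
  have hθ : 0 < θ := by
    rcases hθ0.eq_or_lt with h | h
    · rw [← h] at h3'; linarith
    · exact h
  have hd : 0 < ψ u₂ - ψ u₁ := by linarith
  ext q
  simp only [segment_eq_image', mem_inter_iff, mem_image, mem_ofPred_eq]
  constructor
  · rintro ⟨⟨t, ⟨ht0, ht1⟩, rfl⟩, ht⟩
    simp only [map_add, map_smul, map_sub, smul_eq_mul] at ht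
    refine ⟨t / θ, ⟨by positivity, ?_⟩, ?_⟩
    · rw [div_le_one hθ]
      exact le_of_mul_le_mul_right (by linarith) hd
    · rw [add_sub_cancel_left, smul_smul, div_mul_cancel₀ _ hθ.ne']
  · rintro ⟨t, ⟨ht0, ht1⟩, rfl⟩
    refine ⟨⟨t * θ, ⟨by positivity, by nlinarith⟩, ?_⟩, ?_⟩
    · rw [add_sub_cancel_left, smul_smul]
    · simp only [add_sub_cancel_left, map_add, map_smul, map_sub, smul_eq_mul]
      nlinarith [mul_le_mul_of_nonneg_right ht1 (mul_pos hθ hd).le]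

/-- The point where a segment crosses a hyperplane. -/
theorem exists_segment_inter_level {u₁ u₂ : E} (ψ : E →ₗ[ℝ] ℝ) {s : ℝ} (h1 : ψ u₁ < s)
    (h2 : s < ψ u₂) : ∃ u₃, segment ℝ u₁ u₂ ∩ {q | ψ q = s} = {u₃} := by
  have hd : 0 < ψ u₂ - ψ u₁ := by linarith
  refine ⟨u₁ + ((s - ψ u₁) / (ψ u₂ - ψ u₁)) • (u₂ - u₁), ?_⟩
  ext q
  simp only [segment_eq_image', mem_inter_iff, mem_image, mem_ofPred_eq, mem_singleton_iff]
  constructor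
  · rintro ⟨⟨t, -, rfl⟩, ht⟩
    simp only [map_add, map_smul, map_sub, smul_eq_mul] at ht
    have : t = (s - ψ u₁) / (ψ u₂ - ψ u₁) := by
      rw [eq_div_iff hd.ne']; linarith
    rw [this]
  · rintro rfl
    refine ⟨⟨_, ⟨div_nonneg (by linarith) hd.le, ?_⟩, rfl⟩, ?_⟩
    · rw [div_le_one hd]; linarith
    · simp only [map_add, map_smul, map_sub, smul_eq_mul]
      field_simp
      ring

/-- The polyhedron `{q : φ_i(q) ≤ c_i for all i}`. -/
def polyhedron {ι : Type*} (φ : ι → E →ₗ[ℝ] ℝ) (c : ι → ℝ) : Set E :=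
  {q | ∀ i, φ i q ≤ c i}

variable {ι : Type*} {φ : ι → E →ₗ[ℝ] ℝ} {c : ι → ℝ}

theorem convex_polyhedron : Convex ℝ (polyhedron φ c) := by
  intro x hx y hy a b ha hb hab i
  have h1 := mul_le_mul_of_nonneg_left (hx i) ha
  have h2 := mul_le_mul_of_nonneg_left (hy i) hb
  simp only [map_add, map_smul, smul_eq_mul]
  calc _ ≤ a * c i + b * c i := add_le_add h1 h2
    _ = c i := by rw [← add_mul, hab, one_mul]

/-- Tight constraints do not increase along `d`, and slack ones stay slack for small steps by
continuity. -/
theorem eventually_add_smul_mem_polyhedron [Finite ι] {y d : E} (hy : y ∈ polyhedron φ c)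
    (hd : ∀ i, φ i y = c i → φ i d ≤ 0) :
    ∀ᶠ ε : ℝ in 𝓝[>] 0, y + ε • d ∈ polyhedron φ c := by
  refine eventually_all.2 fun i => ?_
  simp only [map_add, map_smul, smul_eq_mul]
  rcases (hy i).eq_or_lt with h | h
  · filter_upwards [self_mem_nhdsWithin] with ε (hε : 0 < ε)
    nlinarith [hd i h]
  · have hc : Tendsto (fun ε : ℝ => φ i y + ε * φ i d) (𝓝[>] 0) (𝓝 (φ i y + 0 * φ i d)) :=
      (Continuous.tendsto (by fun_prop) 0).mono_left nhdsWithin_le_nhds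
    rw [zero_mul, add_zero] at hc
    exact (hc.eventually_lt_const h).mono fun _ h => h.le

theorem freeDirection_polyhedron [Finite ι] {y d : E} (hy : y ∈ polyhedron φ c) :
    FreeDirection (polyhedron φ c) y d ↔ ∀ i, φ i y = c i → φ i d = 0 := by
  constructor
  · rintro ⟨ε, hε, h1, h2⟩ i hi
    have h1 := h1 i
    have h2 := h2 i
    simp only [map_add, map_sub, map_smul, smul_eq_mul, hi] at h1 h2
    have : ε * φ i d = 0 := by linarith
    simpa [hε.ne'] using this
  · intro h
    have h1 := eventually_add_smul_mem_polyhedron hy (d := d) fun i hi => (h i hi).le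
    have h2 := eventually_add_smul_mem_polyhedron hy (d := -d) fun i hi => by simp [h i hi]
    obtain ⟨ε, ⟨h1, h2⟩, hε⟩ := ((h1.and h2).and self_mem_nhdsWithin).exists
    exact ⟨ε, hε, h1, by simpa [sub_eq_add_neg] using h2⟩

/-- An extreme point is determined by its set of tight constraints: if two share this set, their
difference is a free direction, hence zero. -/
theorem finite_extremePoints_polyhedron [Finite ι] :
    ((polyhedron φ c).extremePoints ℝ).Finite := by
  refine Set.Finite.of_finite_image (f := fun y => {i | φ i y = c i}) (toFinite _) ?_
  intro y hy z hz hyz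
  have h := ((mem_extremePoints_iff_freeDirection convex_polyhedron).1 hy).2 (z - y)
    ((freeDirection_polyhedron hy.1).2 fun i hi => ?_)
  · exact (sub_eq_zero.1 h).symm
  · have : φ i z = c i := (Set.ext_iff.1 hyz i).1 hi
    rw [map_sub, this, hi, sub_self]

/-- If the free directions of a polyhedron at `y` span at most a line, then this line through `y`
meets the polyhedron in a face. -/
theorem isExtreme_line_of_freeDirection [Finite ι] {y d : E} (hy : y ∈ polyhedron φ c)
    (hd : FreeDirection (polyhedron φ c) y d)
    (h : ∀ d', FreeDirection (polyhedron φ c) y d' → ∃ t : ℝ, d' = t • d) :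
    IsExtreme ℝ (polyhedron φ c) {q | q ∈ polyhedron φ c ∧ ∃ t : ℝ, q = y + t • d} := by
  refine ⟨fun q hq => hq.1, ?_⟩
  rintro a ha b hb q ⟨hq, t, rfl⟩ hab
  refine ⟨ha, ?_⟩
  -- A constraint tight at `y` kills `d`, so it is tight on the whole line, in particular at a point
  -- strictly between `a` and `b`; then it is tight at `a` too.
  have h1 : FreeDirection (polyhedron φ c) y (a - y) := by
    rw [freeDirection_polyhedron hy] at hd ⊢
    intro i hi
    obtain ⟨x, z, hx, hz, hxz, hq⟩ := hab
    have h2 := congrArg (φ i) hq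
    simp only [map_add, map_smul, smul_eq_mul, hd i hi, hi, mul_zero, add_zero]
      at h2
    rw [map_sub, hi, eq_of_convex_comb_eq hx hz hxz (ha i) (hb i) h2, sub_self]
  obtain ⟨r, hr⟩ := h _ h1
  exact ⟨r, by rw [← hr]; abel⟩

/-- At a vertex of a polyhedron that lies in a hyperplane not containing the polyhedron, some
point outside of the hyperplane lies in a face of dimension one containing the vertex. -/
theorem exists_line_at_vertex [Finite ι] {u : E} (hu : u ∈ (polyhedron φ c).extremePoints ℝ)
    (ψ : E →ₗ[ℝ] ℝ) (hψ : ∃ y ∈ polyhedron φ c, ψ y ≠ ψ u) :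
    ∃ y ∈ polyhedron φ c, ∃ d, ψ d ≠ 0 ∧ FreeDirection (polyhedron φ c) y d ∧
      u = y - d ∧ y + d ∈ polyhedron φ c ∧
      ∀ d', FreeDirection (polyhedron φ c) y d' → ∃ t : ℝ, d' = t • d := by
  set K := polyhedron φ c with hK
  let J : E → Set ι := fun y => {i | φ i u = c i ∧ φ i y = c i}
  -- Among the points off the hyperplane, take one that shares as many tight constraints with `u` as
  -- possible; the segment from `u` to it then runs along an edge.
  obtain ⟨y, ⟨hy, hyu⟩, hmax⟩ : ∃ y, (y ∈ K ∧ ψ y ≠ ψ u) ∧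
      ∀ z, z ∈ K → ψ z ≠ ψ u → (J z).ncard ≤ (J y).ncard := by
    let N : Set ℕ := (fun y => (J y).ncard) '' {y | y ∈ K ∧ ψ y ≠ ψ u}
    have hN : N.Nonempty := by
      obtain ⟨y, h⟩ := hψ
      exact ⟨_, y, h, rfl⟩
    have hb : BddAbove N := by
      refine ⟨(univ : Set ι).ncard, ?_⟩
      rintro _ ⟨y, -, rfl⟩
      exact ncard_le_ncard (subset_univ _)
    obtain ⟨y, hy, h⟩ := Nat.sSup_mem hN hb
    exact ⟨y, hy, fun z hz hz' => by
      have : (J y).ncard = sSup N := h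
      rw [this]; exact le_csSup hb ⟨z, ⟨hz, hz'⟩, rfl⟩⟩
  have hu' := ((mem_extremePoints_iff_freeDirection convex_polyhedron).1 hu).2
  have hd0 : ψ (y - u) ≠ 0 := by rwa [map_sub, sub_ne_zero]
  have key : ∀ d', (∀ i ∈ J y, φ i d' = 0) → ψ d' = 0 → d' = 0 := by
    intro d₀ hd₀ hψd₀
    by_contra hne
    obtain ⟨d', hd', hψd', i₁, hi₁, hpos₁⟩ : ∃ d', (∀ i ∈ J y, φ i d' = 0) ∧ ψ d' = 0 ∧
        ∃ i, φ i u = c i ∧ 0 < φ i d' := by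
      have : ¬ FreeDirection K u d₀ := fun h => hne (hu' _ h)
      rw [hK, freeDirection_polyhedron hu.1] at this
      push Not at this
      obtain ⟨i, hi, hi'⟩ := this
      rcases lt_or_gt_of_ne hi' with h | h
      · exact ⟨-d₀, fun i hi => by simp [hd₀ i hi], by simp [hψd₀], i, hi, by simpa using h⟩
      · exact ⟨d₀, hd₀, hψd₀, i, hi, h⟩
    -- Ratio test: going from `y` along `d'`, `i₀` is the first constraint tight at `u` to reach its
    -- bound.
    obtain ⟨i₀, ⟨hi₀, hpos⟩, hmin⟩ := (toFinite {i | φ i u = c i ∧ 0 < φ i d'}).exists_minimalFor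
      (fun i => (c i - φ i y) / φ i d') _ ⟨i₁, hi₁, hpos₁⟩
    set r := (c i₀ - φ i₀ y) / φ i₀ d' with hr
    have hr0 : 0 ≤ r := div_nonneg (by linarith [hy i₀]) hpos.le
    have hle : ∀ i, φ i u = c i → φ i (y - u + r • d') ≤ 0 := by
      intro i hi
      simp only [map_add, map_sub, map_smul, smul_eq_mul, hi]
      rcases lt_or_ge 0 (φ i d') with h | h
      · have : r ≤ (c i - φ i y) / φ i d' := by
          rcases le_total r ((c i - φ i y) / φ i d') with h' | h'
          · exact h'
          · exact hmin ⟨hi, h⟩ h'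
        rw [le_div_iff₀ h] at this
        linarith
      · nlinarith [hy i]
    -- Constraints slack at `u` may fail at `y + r • d'`, so only a small step from `u` towards that
    -- point is taken. It keeps `J y` tight and adds `i₀`, against maximality.
    obtain ⟨ε, hmem, hε⟩ :=
      ((eventually_add_smul_mem_polyhedron hu.1 hle).and self_mem_nhdsWithin).exists
    have hε : 0 < ε := hε
    have hlt := hmax (u + ε • (y - u + r • d')) hmem (by
      simp only [map_add, map_smul, hψd', smul_eq_mul, mul_zero, add_zero, ne_eq, add_eq_left,
        mul_eq_zero, hd0, hε.ne', or_self, not_false_eq_true])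
    refine absurd hlt (not_le.2 (ncard_lt_ncard ⟨?_, fun hsub => ?_⟩))
    · rintro i hi
      refine ⟨hi.1, ?_⟩
      simp [hd' i hi, hi.1, hi.2]
    · have : i₀ ∈ J y := hsub ⟨hi₀, by
        simp only [map_add, map_sub, map_smul, smul_eq_mul, hi₀, hr]
        field_simp
        ring⟩
      exact hpos.ne' (hd' i₀ this)
  -- The midpoint of `u` and `y` serves as the point of the line: all of `J y` is tight there and `y
  -- - u` is free.
  have hmid : u + (1 / 2 : ℝ) • (y - u) ∈ K := by
    have := convex_polyhedron hu.1 hy (a := 1 / 2) (b := 1 / 2) (by norm_num) (by norm_num)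
      (by norm_num)
    convert this using 1
    module
  have hfree : FreeDirection K (u + (1 / 2 : ℝ) • (y - u)) ((1 / 2 : ℝ) • (y - u)) := by
    refine ⟨1, one_pos, ?_, ?_⟩
    · convert hy using 1; module
    · convert hu.1 using 1; module
  refine ⟨_, hmid, (1 / 2 : ℝ) • (y - u), ?_, hfree, by abel, ?_, ?_⟩
  · rw [map_smul, smul_eq_mul]; exact mul_ne_zero (by norm_num) hd0
  · convert hy using 1; module
  · intro d' hd'
    refine ⟨ψ d' / ψ (y - u) * 2, ?_⟩
    have := key (d' - (ψ d' / ψ (y - u)) • (y - u)) (fun i hi => ?_) ?_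
    · rw [sub_eq_zero] at this
      rw [smul_smul, mul_assoc, mul_one_div_cancel two_ne_zero, mul_one]
      exact this
    · have h1 := (freeDirection_polyhedron hmid).1 hd' i (by
        simp only [map_add, map_sub, map_smul, hi.1, hi.2, sub_self, smul_zero, add_zero])
      simp [h1, hi.1, hi.2]
    · rw [map_sub, map_smul, smul_eq_mul, div_mul_cancel₀ _ hd0, sub_self]

end Convex

end DualSearch

/-! ### Vertices and edges of the skeleton as faces -/

namespace DualSearch

open Set Filter Topology

variable {m : ℕ}

/-- A proper combination reduces to two points: one chosen `w i`, and the remaining ones averaged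
into a point of `K`. The bound `a i < 1` leaves positive weight for that average. -/
theorem isExtreme_iff_isProperConvexComb {K e : Set ((Fin m → ℝ) × ℝ)} (hK : Convex ℝ K) :
    IsExtreme ℝ K e ↔ e ⊆ K ∧ ∀ y ∈ e, ∀ W ⊆ K, IsProperConvexComb y W → W ⊆ e := by
  constructor
  · intro h
    refine ⟨h.1, ?_⟩
    rintro _ hy _ hW ⟨k, w, a, rfl, ha, hsum, rfl⟩
    rintro _ ⟨i, rfl⟩
    have hw : ∀ j, w j ∈ K := fun j => hW ⟨j, rfl⟩
    have h1 : 0 < 1 - a i := by linarith [(ha i).2]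
    have hs : a i + ∑ j ∈ Finset.univ.erase i, a j = 1 := by
      rw [Finset.add_sum_erase _ _ (Finset.mem_univ i), hsum]
    have hz : ∑ j ∈ Finset.univ.erase i, (a j / (1 - a i)) • w j ∈ K := by
      refine hK.sum_mem (fun j _ => div_nonneg (ha j).1.le h1.le) ?_ fun j _ => hw j
      rw [← Finset.sum_div, div_eq_one_iff_eq h1.ne']
      linarith
    refine h.2 (hw i) hz hy ⟨a i, 1 - a i, (ha i).1, h1, by ring, ?_⟩
    rw [Finset.smul_sum, ← Finset.add_sum_erase _ _ (Finset.mem_univ i)]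
    congr 1
    refine Finset.sum_congr rfl fun j _ => ?_
    rw [smul_smul, mul_div_cancel₀ _ h1.ne']
  · rintro ⟨hsub, h⟩
    refine ⟨hsub, ?_⟩
    rintro x hx y hy z hz ⟨a, b, ha, hb, hab, rfl⟩
    refine h _ hz {x, y} (by rintro _ (rfl | rfl) <;> assumption) ?_ (mem_insert _ _)
    refine ⟨2, ![x, y], ![a, b], ?_, ?_, by simpa using hab, by simp⟩
    · ext q; simp [eq_comm, or_comm]
    · intro i
      fin_cases i
      · exact ⟨ha, by simp; linarith⟩
      · exact ⟨hb, by simp; linarith⟩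

theorem vertices_eq_extremePoints {K : Set ((Fin m → ℝ) × ℝ)} (hK : Convex ℝ K) :
    vertices K = K.extremePoints ℝ := by
  ext v
  rw [← isExtreme_singleton, isExtreme_iff_isProperConvexComb hK]
  simp only [vertices, mem_ofPred_eq, singleton_subset_iff, mem_singleton_iff, forall_eq]
  refine and_congr_right fun _ => forall₃_congr fun U _ hU => ?_
  rw [subset_singleton_iff_eq]
  refine ⟨Or.inr, ?_⟩
  rintro (rfl | h)
  -- The empty set is excluded because its weights would sum to `0`.
  · obtain ⟨k, w, a, h, -, h1, -⟩ := hU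
    rw [range_eq_empty_iff] at h
    simp at h1
  · exact h

theorem mem_boundedEdges_iff {K e : Set ((Fin m → ℝ) × ℝ)} (hK : Convex ℝ K) :
    e ∈ boundedEdges K ↔ ∃ u ∈ K.extremePoints ℝ, ∃ v ∈ K.extremePoints ℝ,
      u ≠ v ∧ e = segment ℝ u v ∧ IsExtreme ℝ K e := by
  simp only [boundedEdges, mem_ofPred_eq, vertices_eq_extremePoints hK,
    isExtreme_iff_isProperConvexComb hK]
  refine ⟨?_, ?_⟩
  · rintro ⟨u, hu, v, hv, huv, rfl, h⟩
    exact ⟨u, hu, v, hv, huv, rfl, hK.segment_subset hu.1 hv.1, h⟩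
  · rintro ⟨u, hu, v, hv, huv, rfl, -, h⟩
    exact ⟨u, hu, v, hv, huv, rfl, h⟩

theorem mem_skeleton_edges_iff {M : ℝ} {g : (Fin m → ℝ) → ℝ} {e : Set ((Fin m → ℝ) × ℝ)}
    (hK : Convex ℝ (hypograph M g)) :
    e ∈ (skeleton M g).2 ↔ (∃ u ∈ (hypograph M g).extremePoints ℝ,
        ∃ v ∈ (hypograph M g).extremePoints ℝ,
        u ≠ v ∧ e = segment ℝ u v ∧ IsExtreme ℝ (hypograph M g) e) ∨
      ∃ u ∈ (hypograph M g).extremePoints ℝ, u.1 ∈ corners m M ∧ e = downRay u := by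
  rw [← mem_boundedEdges_iff hK, ← vertices_eq_extremePoints hK]
  rfl

theorem segment_ne_downRay (a b u : (Fin m → ℝ) × ℝ) : segment ℝ a b ≠ downRay u := by
  intro h
  -- A point of the ray lower than both ends of the segment.
  have h1 : (u.1, min u.2 (min a.2 b.2 - 1)) ∈ segment ℝ a b := by
    rw [h]
    exact ⟨rfl, min_le_left _ _⟩
  obtain ⟨s, t, hs, ht, hst, hq⟩ := h1
  have h2 := congrArg Prod.snd hq
  simp only [Prod.snd_add, Prod.smul_snd, smul_eq_mul] at h2
  have h3 := min_le_right u.2 (min a.2 b.2 - 1)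
  rw [← h2] at h3
  have h4 := mul_le_mul_of_nonneg_left (min_le_left a.2 b.2) hs
  have h5 := mul_le_mul_of_nonneg_left (min_le_right a.2 b.2) ht
  have h6 : s * min a.2 b.2 + t * min a.2 b.2 = min a.2 b.2 := by rw [← add_mul, hst, one_mul]
  linarith

theorem downRay_injective {u v : (Fin m → ℝ) × ℝ} (h : downRay u = downRay v) : u = v := by
  have h1 : u ∈ downRay v := h ▸ ⟨rfl, le_rfl⟩
  have h2 : v ∈ downRay u := h ▸ ⟨rfl, le_rfl⟩
  exact Prod.ext h1.1 (le_antisymm h1.2 h2.2)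

theorem eq_of_mem_openSegment_corners {M : ℝ} {lam a b : Fin m → ℝ} (h : lam ∈ corners m M)
    (ha : a ∈ box m M) (hb : b ∈ box m M) (hab : lam ∈ openSegment ℝ a b) : a = lam := by
  obtain ⟨s, t, hs, ht, hst, rfl⟩ := hab
  ext i
  simp only [Pi.add_apply, Pi.smul_apply, smul_eq_mul]
  rcases h i with h | h <;> simp only [Pi.add_apply, Pi.smul_apply, smul_eq_mul] at h
  · have := eq_of_convex_comb_eq hs ht hst (A := -a i) (B := -b i) (C := M)
      (by linarith [(ha i).1]) (by linarith [(hb i).1]) (by linarith)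
    linarith
  · rw [h]
    exact eq_of_convex_comb_eq hs ht hst (ha i).2 (hb i).2 h

variable {M : ℝ} {g : (Fin m → ℝ) → ℝ}

theorem isExtreme_downRay {lam : Fin m → ℝ} (h : lam ∈ corners m M) (hM : 0 < M) :
    IsExtreme ℝ (hypograph M g) (downRay (lam, g lam)) := by
  constructor
  · rintro ⟨q, z⟩ ⟨rfl : q = lam, hz⟩
    refine ⟨fun i => ?_, hz⟩
    show q i ∈ _
    rcases h i with h | h <;> rw [h] <;> constructor <;> linarith
  · rintro a ha b hb q hq ⟨s, t, hs, ht, hst, rfl⟩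
    have : a.1 = lam := eq_of_mem_openSegment_corners h ha.1 hb.1
      ⟨s, t, hs, ht, hst, hq.1⟩
    refine ⟨this, ?_⟩
    show a.2 ≤ g lam
    rw [← this]
    exact ha.2

theorem mem_extremePoints_of_corner {lam : Fin m → ℝ} (h : lam ∈ corners m M) (hM : 0 < M) :
    (lam, g lam) ∈ (hypograph M g).extremePoints ℝ := by
  refine (isExtreme_downRay h hM).extremePoints_subset_extremePoints ⟨⟨rfl, le_rfl⟩, ?_⟩
  rintro a ha b hb ⟨s, t, hs, ht, hst, hab⟩
  refine Prod.ext ha.1 ?_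
  exact eq_of_convex_comb_eq hs ht hst ha.2 hb.2 (congrArg Prod.snd hab)

theorem snd_eq_of_mem_extremePoints {u : (Fin m → ℝ) × ℝ}
    (hu : u ∈ (hypograph M g).extremePoints ℝ) : u.2 = g u.1 := by
  have h1 : (u.1, g u.1) ∈ hypograph M g := ⟨hu.1.1, le_rfl⟩
  -- The reflection through `u` of the point of the graph above `u`.
  have h2 : (u.1, 2 * u.2 - g u.1) ∈ hypograph M g :=
    ⟨hu.1.1, by have := hu.1.2; simp only; linarith⟩
  have := hu.2 h1 h2 ⟨1 / 2, 1 / 2, by norm_num, by norm_num, by norm_num, ?_⟩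
  · rw [← this]
  · ext
    · simp; ring
    · simp; ring

theorem isExtreme_of_mem_skeleton (hM : 0 < M) (hK : Convex ℝ (hypograph M g))
    {e : Set ((Fin m → ℝ) × ℝ)} (he : e ∈ (skeleton M g).2) : IsExtreme ℝ (hypograph M g) e := by
  rcases (mem_skeleton_edges_iff hK).1 he with ⟨u, hu, v, hv, huv, rfl, h⟩ | ⟨u, hu, hc, rfl⟩
  · exact h
  · have : u = (u.1, g u.1) := Prod.ext rfl (snd_eq_of_mem_extremePoints hu)
    rw [this]
    exact isExtreme_downRay hc hM

theorem subset_line_of_mem_skeleton (hK : Convex ℝ (hypograph M g))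
    {e : Set ((Fin m → ℝ) × ℝ)} (he : e ∈ (skeleton M g).2) :
    ∃ p d, ∀ q ∈ e, ∃ t : ℝ, q = p + t • d := by
  rcases (mem_skeleton_edges_iff hK).1 he with ⟨u, hu, v, hv, huv, rfl, h⟩ | ⟨u, hu, hc, rfl⟩
  · refine ⟨u, v - u, ?_⟩
    rw [segment_eq_image']
    rintro _ ⟨t, -, rfl⟩
    exact ⟨t, rfl⟩
  · refine ⟨u, (0, 1), fun q hq => ⟨q.2 - u.2, ?_⟩⟩
    ext
    · simp [hq.1]
    · simp

/-- An edge that is not contained in a hyperplane meets it in at most one point. -/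
theorem subsingleton_edge_inter_level (hK : Convex ℝ (hypograph M g))
    {e : Set ((Fin m → ℝ) × ℝ)} (he : e ∈ (skeleton M g).2)
    (ψ : (Fin m → ℝ) × ℝ →ₗ[ℝ] ℝ) {s : ℝ} (hs : ¬ e ⊆ {q | ψ q = s}) :
    (e ∩ {q | ψ q = s}).Subsingleton := by
  obtain ⟨p, d, h⟩ := subset_line_of_mem_skeleton hK he
  rintro a ⟨ha, ha'⟩ b ⟨hb, hb'⟩
  by_contra hne
  apply hs
  intro q hq
  obtain ⟨x, rfl⟩ := h a ha
  obtain ⟨y, rfl⟩ := h b hb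
  obtain ⟨z, rfl⟩ := h q hq
  simp only [mem_ofPred_eq, map_add, map_smul, smul_eq_mul] at ha' hb' ⊢
  have hxy : x - y ≠ 0 := by
    rw [sub_ne_zero]
    rintro rfl
    exact hne rfl
  have : ψ d = 0 := by
    have : (x - y) * ψ d = 0 := by linarith
    simpa [hxy] using this
  rw [this] at ha' ⊢
  linarith

/-- Over a non-corner some coordinate can be moved both ways inside the box. Low enough, both
displaced points lie below `g`, and their midpoint is on the ray while they are not. -/
theorem mem_corners_of_isExtreme_downRay {u : (Fin m → ℝ) × ℝ}
    (h : IsExtreme ℝ (hypograph M g) (downRay u)) : u.1 ∈ corners m M := by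
  have hu : u ∈ hypograph M g := h.1 ⟨rfl, le_rfl⟩
  intro i
  by_contra! hi
  have h1 : -M < u.1 i := lt_of_le_of_ne (hu.1 i).1 hi.1.symm
  have h2 : u.1 i < M := lt_of_le_of_ne (hu.1 i).2 hi.2
  obtain ⟨ε, hε, hε'⟩ := exists_between (lt_min (sub_pos.2 h2) (by linarith : 0 < u.1 i + M))
  have hε1 := hε'.trans_le (min_le_left _ _)
  have hε2 := hε'.trans_le (min_le_right _ _)
  let a : ℝ → (Fin m → ℝ) := fun r => u.1 + Pi.single i r
  have hbox : ∀ r, |r| ≤ ε → a r ∈ box m M := by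
    intro r hr j
    have := abs_le.1 hr
    rcases eq_or_ne j i with rfl | hj
    · simp only [a, Pi.add_apply, Pi.single_eq_same]
      constructor <;> linarith
    · simpa [a, hj] using hu.1 j
  let z := min u.2 (min (g (a ε)) (g (a (-ε))))
  have hm1 : (a ε, z) ∈ hypograph M g :=
    ⟨hbox _ (abs_of_pos hε).le, (min_le_right _ _).trans (min_le_left _ _)⟩
  have hm2 : (a (-ε), z) ∈ hypograph M g :=
    ⟨hbox _ (by rw [abs_neg, abs_of_pos hε]), (min_le_right _ _).trans (min_le_right _ _)⟩
  have := h.2 hm1 hm2 (z := (u.1, z)) ⟨rfl, min_le_left _ _⟩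
    ⟨1 / 2, 1 / 2, by norm_num, by norm_num, by norm_num, ?_⟩
  · have := congrFun this.1 i
    simp [a, hε.ne'] at this
  · ext j
    · simp only [a, Prod.smul_mk, Prod.mk_add_mk, Pi.add_apply, Pi.smul_apply, smul_eq_mul,
        Pi.single_neg, Pi.neg_apply]
      ring
    · simp only [Prod.smul_mk, Prod.mk_add_mk, smul_eq_mul]
      ring

variable {ι : Type*} {φ : ι → (Fin m → ℝ) × ℝ →ₗ[ℝ] ℝ} {c : ι → ℝ}

theorem isClosed_polyhedron : IsClosed (polyhedron φ c) := by
  simp only [polyhedron, ofPred_forall]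
  exact isClosed_iInter fun i =>
    isClosed_le (φ i).continuous_of_finiteDimensional continuous_const

/-- A one-dimensional face of the region below `g` is an edge of the skeleton. -/
theorem line_mem_skeleton [Finite ι] (hφ : hypograph M g = polyhedron φ c)
    {y d : (Fin m → ℝ) × ℝ} (hy : y ∈ hypograph M g) (hd0 : d ≠ 0)
    (hd : FreeDirection (hypograph M g) y d)
    (h : ∀ d', FreeDirection (hypograph M g) y d' → ∃ t : ℝ, d' = t • d) :
    {q | q ∈ hypograph M g ∧ ∃ t : ℝ, q = y + t • d} ∈ (skeleton M g).2 := by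
  have hK : Convex ℝ (hypograph M g) := hφ ▸ convex_polyhedron
  have hext : IsExtreme ℝ (hypograph M g)
      {q | q ∈ hypograph M g ∧ ∃ t : ℝ, q = y + t • d} := by
    rw [hφ] at hy hd h ⊢
    exact isExtreme_line_of_freeDirection hy hd h
  rw [mem_skeleton_edges_iff hK]
  -- A vertical line meets the region in a ray ending at the graph of `g`; on any other line the box
  -- bounds the parameter, leaving a segment.
  by_cases hd1 : d.1 = 0
  · right
    have hd2 : d.2 ≠ 0 := fun h => hd0 (Prod.ext hd1 h)
    have heq : {q | q ∈ hypograph M g ∧ ∃ t : ℝ, q = y + t • d} = downRay (y.1, g y.1) := by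
      ext q
      constructor
      · rintro ⟨hq, t, rfl⟩
        have : (y + t • d).1 = y.1 := by simp [hd1]
        exact ⟨this, by have := hq.2; simp_all⟩
      · rintro ⟨h1 : q.1 = y.1, h2 : q.2 ≤ g y.1⟩
        refine ⟨⟨h1 ▸ hy.1, h1 ▸ h2⟩, (q.2 - y.2) / d.2, ?_⟩
        ext
        · simp [h1, hd1]
        · simp only [Prod.snd_add, Prod.smul_snd, smul_eq_mul]
          field_simp
          ring
    rw [heq] at hext ⊢
    have hc := mem_corners_of_isExtreme_downRay hext
    refine ⟨(y.1, g y.1), ?_, hc, rfl⟩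
    refine hext.extremePoints_subset_extremePoints ⟨⟨rfl, le_rfl⟩, ?_⟩
    rintro a ha b hb ⟨s, t, hs, ht, hst, hab⟩
    exact Prod.ext ha.1 (eq_of_convex_comb_eq hs ht hst ha.2 hb.2 (congrArg Prod.snd hab))
  · left
    let T : Set ℝ := {t | y + t • d ∈ hypograph M g}
    obtain ⟨i, hi⟩ : ∃ i, d.1 i ≠ 0 := by
      by_contra! h
      exact hd1 (funext h)
    have hTcl : IsClosed T := by
      have : IsClosed (hypograph M g) := hφ ▸ isClosed_polyhedron
      exact this.preimage (by fun_prop : Continuous fun t : ℝ => y + t • d)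
    -- `t * d.1 i` is a difference of two numbers in `[-M, M]`.
    have hTb : T ⊆ Metric.closedBall 0 (2 * M / |d.1 i|) := by
      intro t ht
      have h1 := ht.1 i
      have h2 := hy.1 i
      simp only [Prod.fst_add, Prod.smul_fst, Pi.add_apply, Pi.smul_apply, smul_eq_mul] at h1
      rw [mem_closedBall_zero_iff, Real.norm_eq_abs, le_div_iff₀ (abs_pos.2 hi), ← abs_mul,
        abs_le]
      constructor <;> linarith [h1.1, h1.2, h2.1, h2.2]
    have hTc : IsCompact T := (isCompact_closedBall _ _).of_isClosed_subset hTcl hTb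
    have hTconv : Convex ℝ T := by
      intro s hs t ht a b ha hb hab
      have hs : y + s • d ∈ hypograph M g := hs
      have ht : y + t • d ∈ hypograph M g := ht
      have := hK hs ht ha hb hab
      have heq : y + (a • s + b • t) • d = a • (y + s • d) + b • (y + t • d) := by
        calc _ = (1 : ℝ) • y + (a • s + b • t) • d := by rw [one_smul]
          _ = _ := by rw [← hab]; simp only [smul_eq_mul]; module
      show y + (a • s + b • t) • d ∈ hypograph M g
      rwa [heq]
    obtain ⟨ε, hε, hε1, hε2⟩ := hd
    have hTne : T.Nonempty := ⟨ε, hε1⟩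
    have hTIcc := eq_Icc_of_connected_compact (hTconv.isConnected hTne) hTc
    set α := sInf T
    set β := sSup T
    have hεT : ε ∈ Icc α β := hTIcc ▸ (show ε ∈ T from hε1)
    have hεT' : -ε ∈ Icc α β := hTIcc ▸ (show -ε ∈ T by
      show y + (-ε) • d ∈ hypograph M g
      rwa [neg_smul, ← sub_eq_add_neg])
    have hαβ : α < β := by linarith [hεT.2, hεT'.1]
    have heq : {q | q ∈ hypograph M g ∧ ∃ t : ℝ, q = y + t • d}
        = segment ℝ (y + α • d) (y + β • d) := by
      have : {q | q ∈ hypograph M g ∧ ∃ t : ℝ, q = y + t • d}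
          = AffineMap.lineMap (k := ℝ) y (y + d) '' segment ℝ α β := by
        rw [segment_eq_Icc hαβ.le, ← hTIcc]
        ext q
        simp only [mem_ofPred_eq, mem_image, AffineMap.lineMap_apply, vsub_eq_sub,
          add_sub_cancel_left, vadd_eq_add, T]
        constructor
        · rintro ⟨hq, t, rfl⟩
          exact ⟨t, hq, add_comm _ _⟩
        · rintro ⟨t, ht, rfl⟩
          exact ⟨by rwa [add_comm], t, add_comm _ _⟩
      rw [this, image_segment]
      simp [AffineMap.lineMap_apply, add_comm]
    have hne : y + α • d ≠ y + β • d := by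
      intro h
      rw [add_right_inj] at h
      exact hαβ.ne (smul_left_injective ℝ hd0 h)
    rw [heq] at hext ⊢
    refine ⟨_, hext.extremePoints_subset_extremePoints ?_, _,
      hext.extremePoints_subset_extremePoints ?_, hne, rfl, hext⟩
    · exact left_mem_extremePoints_segment _ _
    · rw [segment_symm]
      exact left_mem_extremePoints_segment _ _

end DualSearch

/-! ### Vertices after a cut by a half-space -/

namespace DualSearch

open Set Filter Topology

theorem FreeDirection.inter_halfspace {E : Type*} [AddCommGroup E] [Module ℝ E] {K : Set E}
    (hK : Convex ℝ K) {y d : E} (hy : y ∈ K) (h : FreeDirection K y d) (ψ : E →ₗ[ℝ] ℝ) {s : ℝ}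
    (hs : ψ y < s) : FreeDirection (K ∩ {q | ψ q ≤ s}) y d := by
  obtain ⟨ε, hε, h1, h2⟩ := h
  -- A step length that uses up at most the slack of `ψ` at `y`; the `+ 1` covers `ψ d = 0`.
  have hr : 0 < (s - ψ y) / (|ψ d| + 1) := div_pos (by linarith) (by positivity)
  set δ := min ε ((s - ψ y) / (|ψ d| + 1)) with hδ
  have hδ0 : 0 < δ := lt_min hε hr
  have hle : δ * |ψ d| ≤ s - ψ y := by
    have : δ * (|ψ d| + 1) ≤ s - ψ y := by
      rw [← le_div_iff₀ (by positivity)]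
      exact min_le_right _ _
    linarith
  have hk : ∀ d', y + ε • d' ∈ K → y + δ • d' ∈ K := by
    intro d' hd'
    have := hK.add_smul_mem hy hd' (t := δ / ε)
      ⟨by positivity, (div_le_one hε).2 (min_le_left _ _)⟩
    rwa [smul_smul, div_mul_cancel₀ _ hε.ne'] at this
  have h3 := neg_abs_le (ψ d)
  have h4 := le_abs_self (ψ d)
  refine ⟨δ, hδ0, ⟨hk d h1, ?_⟩, ⟨?_, ?_⟩⟩
  · simp only [mem_ofPred_eq, map_add, map_smul, smul_eq_mul]
    nlinarith
  · have := hk (-d) (by simpa [sub_eq_add_neg] using h2)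
    simpa [sub_eq_add_neg] using this
  · simp only [mem_ofPred_eq, map_sub, map_smul, smul_eq_mul]
    nlinarith

variable {m : ℕ} {M : ℝ} {g g' : (Fin m → ℝ) → ℝ} {ι : Type*} [Finite ι]
  {φ : ι → (Fin m → ℝ) × ℝ →ₗ[ℝ] ℝ} {c : ι → ℝ} {ψ : (Fin m → ℝ) × ℝ →ₗ[ℝ] ℝ} {s : ℝ}

/-- A point of a one-dimensional face that is transversal to a hyperplane lies in an edge that is
not contained in this hyperplane. -/
theorem exists_edge_not_subset (hφ : hypograph M g = polyhedron φ c)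
    {y d : (Fin m → ℝ) × ℝ} (hy : y ∈ hypograph M g) (hψd : ψ d ≠ 0)
    (hd : FreeDirection (hypograph M g) y d)
    (h : ∀ d', FreeDirection (hypograph M g) y d' → ∃ t : ℝ, d' = t • d) :
    ∃ e ∈ (skeleton M g).2, ¬ e ⊆ {q | ψ q = s} ∧
      ∀ t : ℝ, y + t • d ∈ hypograph M g → y + t • d ∈ e := by
  refine ⟨_, line_mem_skeleton hφ hy (by rintro rfl; simp at hψd) hd h, fun hsub => ?_,
    fun t ht => ⟨ht, t, rfl⟩⟩
  obtain ⟨ε, hε, h1, -⟩ := hd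
  have h2 : ψ (y + ε • d) = s := hsub ⟨h1, ε, rfl⟩
  have h3 : ψ y = s := hsub ⟨hy, 0, by simp⟩
  rw [map_add, map_smul, h3, smul_eq_mul, add_eq_left] at h2
  exact mul_ne_zero hε.ne' hψd h2

theorem mem_addedVertices_of_mem_extremePoints (hφ : hypograph M g = polyhedron φ c)
    {u : (Fin m → ℝ) × ℝ} (hu : u ∈ (hypograph M g).extremePoints ℝ) (hs : ψ u = s)
    (hψ : ∃ y ∈ hypograph M g, ψ y ≠ s) :
    u ∈ addedVertices (skeleton M g).2 {q | ψ q = s} := by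
  have := exists_line_at_vertex (hφ ▸ hu) ψ (by rwa [hs, ← hφ])
  rw [← hφ] at this
  obtain ⟨y, hy, d, hψd, hd, hud, -, h⟩ := this
  obtain ⟨e, he, hne, hsub⟩ := exists_edge_not_subset (s := s) hφ hy hψd hd h
  refine ⟨e, he, hne, hs, ?_⟩
  have huK := hu.1
  rw [hud, show y - d = y + (-1 : ℝ) • d by module] at huK ⊢
  exact hsub _ huK

/-- The cut destroys every free direction at `w`, so `w` is on the hyperplane and `ψ` is injective
on the free directions of `K` at `w`. These therefore form a line, which spans an edge transversal
to the hyperplane. -/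
theorem mem_addedVertices_of_not_mem_extremePoints (hφ : hypograph M g = polyhedron φ c)
    {w : (Fin m → ℝ) × ℝ} (hw : w ∈ (hypograph M g ∩ {q | ψ q ≤ s}).extremePoints ℝ)
    (hw' : w ∉ (hypograph M g).extremePoints ℝ) :
    w ∈ addedVertices (skeleton M g).2 {q | ψ q = s} := by
  have hK : Convex ℝ (hypograph M g) := hφ ▸ convex_polyhedron
  have hK' : Convex ℝ (hypograph M g ∩ {q | ψ q ≤ s}) :=
    hK.inter (convex_halfSpace_le ψ.isLinear s)
  have hzero := ((mem_extremePoints_iff_freeDirection hK').1 hw).2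
  obtain ⟨d, hd, hd0⟩ : ∃ d, FreeDirection (hypograph M g) w d ∧ d ≠ 0 := by
    by_contra! h
    exact hw' ((mem_extremePoints_iff_freeDirection hK).2 ⟨hw.1.1, h⟩)
  have hs : ψ w = s := by
    by_contra hne
    exact hd0 (hzero d (hd.inter_halfspace hK hw.1.1 ψ (lt_of_le_of_ne hw.1.2 hne)))
  have hker : ∀ d', FreeDirection (hypograph M g) w d' → ψ d' = 0 → d' = 0 := by
    rintro d' ⟨ε, hε, h1, h2⟩ h0
    exact hzero d' ⟨ε, hε, ⟨h1, by simp [h0, hs]⟩, ⟨h2, by simp [h0, hs]⟩⟩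
  have hψd : ψ d ≠ 0 := fun h => hd0 (hker d hd h)
  have hline : ∀ d', FreeDirection (hypograph M g) w d' → ∃ t : ℝ, d' = t • d := by
    intro d' hd'
    refine ⟨ψ d' / ψ d, sub_eq_zero.1 (hker _ ?_ ?_)⟩
    · have hwK := hw.1.1
      rw [hφ] at hd hd' hwK ⊢
      rw [freeDirection_polyhedron hwK] at hd hd' ⊢
      intro i hi
      simp [hd i hi, hd' i hi]
    · rw [map_sub, map_smul, smul_eq_mul, div_mul_cancel₀ _ hψd, sub_self]
  obtain ⟨e, he, hne, hsub⟩ := exists_edge_not_subset (s := s) hφ hw.1.1 hψd hd hline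
  refine ⟨e, he, hne, hs, ?_⟩
  have := hsub 0
  simp only [zero_smul, add_zero] at this
  exact this hw.1.1

omit [Finite ι] in
-- An open segment of the cut region through `u` has its ends both in the face `ψ = s` and in the
-- edge, and these meet only in `u`.
theorem addedVertices_subset (hM : 0 < M) (hK : Convex ℝ (hypograph M g)) :
    addedVertices (skeleton M g).2 {q | ψ q = s} ⊆
      (hypograph M g ∩ {q | ψ q ≤ s}).extremePoints ℝ ∩ {q | ψ q = s} := by
  rintro u ⟨e, he, hne, hu, hue⟩
  have hext := isExtreme_of_mem_skeleton hM hK he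
  refine ⟨⟨⟨hext.1 hue, le_of_eq hu⟩, ?_⟩, hu⟩
  rintro a ha b hb hab
  have hlevel := (isExtreme_inter_level (hypograph M g ∩ {q | ψ q ≤ s}) ψ s fun q hq => hq.2).2
    ha hb ⟨⟨hext.1 hue, le_of_eq hu⟩, hu⟩ hab
  exact subsingleton_edge_inter_level hK he ψ hne
    ⟨hext.2 ha.1 hb.1 hue hab, hlevel.2⟩ ⟨hue, hu⟩

theorem addedVertices_eq (hM : 0 < M) (hφ : hypograph M g = polyhedron φ c)
    (hψ : ∃ y ∈ hypograph M g, ψ y ≠ s) :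
    addedVertices (skeleton M g).2 {q | ψ q = s} =
      (hypograph M g ∩ {q | ψ q = s}).extremePoints ℝ := by
  have hK : Convex ℝ (hypograph M g) := hφ ▸ convex_polyhedron
  have hlev := isExtreme_inter_level (hypograph M g ∩ {q | ψ q ≤ s}) ψ s fun q hq => hq.2
  have heq : hypograph M g ∩ {q | ψ q ≤ s} ∩ {q | ψ q = s} = hypograph M g ∩ {q | ψ q = s} := by
    ext q
    simp only [mem_inter_iff, mem_ofPred_eq]
    exact ⟨fun h => ⟨h.1.1, h.2⟩, fun h => ⟨⟨h.1, h.2.le⟩, h.2⟩⟩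
  rw [heq] at hlev
  rw [hlev.extremePoints_eq]
  ext w
  constructor
  · intro hw
    have := addedVertices_subset hM hK hw
    exact ⟨⟨this.1.1.1, this.2⟩, this.1⟩
  · rintro ⟨⟨-, hs⟩, hw⟩
    by_cases hw' : w ∈ (hypograph M g).extremePoints ℝ
    · exact mem_addedVertices_of_mem_extremePoints hφ hw' hs hψ
    · exact mem_addedVertices_of_not_mem_extremePoints hφ hw hw'

theorem isCompact_box : IsCompact (box m M) := by
  have : box m M = Icc (fun _ => -M) fun _ => M := by
    ext q
    exact ⟨fun h => ⟨fun i => (h i).1, fun i => (h i).2⟩, fun h i => ⟨h.1 i, h.2 i⟩⟩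
  rw [this]
  exact isCompact_Icc

/-- Krein–Milman; the closure can be dropped because the slice is a polyhedron and has finitely many
extreme points. -/
theorem convexHull_extremePoints_level (hφ : hypograph M g = polyhedron φ c)
    (hψ : ψ (0, 1) = 1) :
    convexHull ℝ ((hypograph M g ∩ {q | ψ q = s}).extremePoints ℝ) =
      hypograph M g ∩ {q | ψ q = s} := by
  have hK : Convex ℝ (hypograph M g) := hφ ▸ convex_polyhedron
  have hψc : Continuous ψ := ψ.continuous_of_finiteDimensional
  have hconv : Convex ℝ (hypograph M g ∩ {q | ψ q = s}) :=
    hK.inter (convex_hyperplane ψ.isLinear s)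
  have hfin : ((hypograph M g ∩ {q | ψ q = s}).extremePoints ℝ).Finite := by
    have : hypograph M g ∩ {q | ψ q = s} = polyhedron
        (Sum.elim φ fun b : Bool => if b then ψ else -ψ)
        (Sum.elim c fun b : Bool => if b then s else -s) := by
      rw [hφ]
      ext q
      simp only [polyhedron, mem_inter_iff, mem_ofPred_eq, Sum.forall, Sum.elim_inl, Sum.elim_inr,
        Bool.forall_bool, if_true, Bool.false_eq_true, if_false, LinearMap.neg_apply, neg_le_neg_iff]
      rw [le_antisymm_iff, and_comm (a := s ≤ ψ q)]
    rw [this]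
    exact finite_extremePoints_polyhedron
  -- As `ψ (0, 1) = 1`, the slice lies on the graph of `lam ↦ s - ψ (lam, 0)` over the box.
  have hcomp : IsCompact (hypograph M g ∩ {q | ψ q = s}) := by
    refine ((isCompact_box (m := m) (M := M)).image (f := fun lam : Fin m → ℝ => (lam, s - ψ (lam, 0)))
      (by fun_prop)).of_isClosed_subset ?_ ?_
    · exact (hφ ▸ isClosed_polyhedron).inter (isClosed_eq hψc continuous_const)
    · rintro q ⟨hq, hs⟩
      refine ⟨q.1, hq.1, Prod.ext rfl ?_⟩
      have : q = (q.1, 0) + q.2 • (0, 1) := by ext <;> simp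
      have h2 := congrArg ψ this
      rw [map_add, map_smul, hψ, hs] at h2
      simp only [smul_eq_mul, mul_one] at h2
      show s - ψ (q.1, 0) = q.2
      linarith
  rw [← (hfin.isClosed_convexHull ℝ).closure_eq]
  exact closure_convexHull_extremePoints hcomp hconv

theorem vertices_cut (hM : 0 < M) (hφ : hypograph M g = polyhedron φ c)
    (hcut : hypograph M g' = hypograph M g ∩ {q | ψ q ≤ s}) :
    vertices (hypograph M g') =
      (vertices (hypograph M g) ∪ addedVertices (skeleton M g).2 {q | ψ q = s}) \
        {u | u ∈ vertices (hypograph M g) ∧ s < ψ u} := by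
  have hK : Convex ℝ (hypograph M g) := hφ ▸ convex_polyhedron
  have hK' : Convex ℝ (hypograph M g') :=
    hcut ▸ hK.inter (convex_halfSpace_le ψ.isLinear s)
  rw [vertices_eq_extremePoints hK, vertices_eq_extremePoints hK', hcut]
  ext w
  constructor
  · intro hw
    refine ⟨?_, fun h => not_le.2 h.2 hw.1.2⟩
    by_cases hw' : w ∈ (hypograph M g).extremePoints ℝ
    · exact Or.inl hw'
    · exact Or.inr (mem_addedVertices_of_not_mem_extremePoints hφ hw hw')
  · rintro ⟨h | h, hn⟩
    · have hle : ψ w ≤ s := not_lt.1 fun hlt => hn ⟨h, hlt⟩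
      exact inter_extremePoints_subset_extremePoints_of_subset inter_subset_left ⟨⟨h.1, hle⟩, h⟩
    · exact (addedVertices_subset hM hK h).1

end DualSearch

/-! ### Edges after a cut by a half-space -/

namespace DualSearch

open Set Filter Topology

variable {m : ℕ} {M : ℝ} {g g' : (Fin m → ℝ) → ℝ} {ι : Type*}
  {φ : ι → (Fin m → ℝ) × ℝ →ₗ[ℝ] ℝ} {c : ι → ℝ} {ψ : (Fin m → ℝ) × ℝ →ₗ[ℝ] ℝ} {s : ℝ}

theorem extremePoints_of_le (hcut : hypograph M g' = hypograph M g ∩ {q | ψ q ≤ s})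
    {u : (Fin m → ℝ) × ℝ} (hu : u ∈ (hypograph M g).extremePoints ℝ) (h : ψ u ≤ s) :
    u ∈ (hypograph M g').extremePoints ℝ := by
  rw [hcut]
  exact inter_extremePoints_subset_extremePoints_of_subset inter_subset_left ⟨⟨hu.1, h⟩, hu⟩

/-- The edges without a removed endpoint persist. -/
theorem mem_skeleton_cut_of_not_mem_removedEdges (hK : Convex ℝ (hypograph M g))
    (hK' : Convex ℝ (hypograph M g'))
    (hcut : hypograph M g' = hypograph M g ∩ {q | ψ q ≤ s})
    {e : Set ((Fin m → ℝ) × ℝ)} (he : e ∈ (skeleton M g).2)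
    (hn : e ∉ removedEdges (skeleton M g).2
      {u | u ∈ (hypograph M g).extremePoints ℝ ∧ s < ψ u}) : e ∈ (skeleton M g').2 := by
  rw [mem_skeleton_edges_iff hK']
  rcases (mem_skeleton_edges_iff hK).1 he with ⟨u, hu, v, hv, huv, rfl, h⟩ | ⟨u, hu, hc, rfl⟩
  · have hu' : ψ u ≤ s := not_lt.1 fun hlt =>
      hn ⟨he, u, ⟨hu, hlt⟩, Or.inl ⟨v, segment_symm ℝ u v⟩⟩
    have hv' : ψ v ≤ s := not_lt.1 fun hlt => hn ⟨he, v, ⟨hv, hlt⟩, Or.inl ⟨u, rfl⟩⟩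
    have h1 := extremePoints_of_le hcut hu hu'
    have h2 := extremePoints_of_le hcut hv hv'
    exact Or.inl ⟨u, h1, v, h2, huv, rfl, h.mono (hcut ▸ inter_subset_left)
      (hK'.segment_subset h1.1 h2.1)⟩
  · have hu' : ψ u ≤ s := not_lt.1 fun hlt => hn ⟨he, u, ⟨hu, hlt⟩, Or.inr rfl⟩
    exact Or.inr ⟨u, extremePoints_of_le hcut hu hu', hc, rfl⟩

theorem isExtreme_level (hcut : hypograph M g' = hypograph M g ∩ {q | ψ q ≤ s}) :
    IsExtreme ℝ (hypograph M g') (hypograph M g ∩ {q | ψ q = s}) := by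
  have := isExtreme_inter_level (hypograph M g') ψ s fun q hq => (hcut ▸ hq :
    q ∈ hypograph M g ∩ {q | ψ q ≤ s}).2
  rwa [hcut, inter_assoc, show {q | ψ q ≤ s} ∩ {q | ψ q = s} = {q | ψ q = s} from
    inter_eq_right.2 fun q hq => le_of_eq hq, ← hcut] at this

theorem convex_level (hK : Convex ℝ (hypograph M g)) :
    Convex ℝ (hypograph M g ∩ {q | ψ q = s}) :=
  hK.inter (convex_hyperplane ψ.isLinear s)

/-- The slice is a face of the cut region, and a face of a face is a face. -/
theorem boundedEdges_level_subset (hK : Convex ℝ (hypograph M g))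
    (hK' : Convex ℝ (hypograph M g'))
    (hcut : hypograph M g' = hypograph M g ∩ {q | ψ q ≤ s}) :
    boundedEdges (hypograph M g ∩ {q | ψ q = s}) ⊆ (skeleton M g').2 := by
  intro e he
  obtain ⟨u, hu, v, hv, huv, rfl, h⟩ := (mem_boundedEdges_iff (convex_level hK)).1 he
  have hlev := isExtreme_level hcut
  exact (mem_skeleton_edges_iff hK').2 (Or.inl ⟨u, hlev.extremePoints_subset_extremePoints hu, v,
    hlev.extremePoints_subset_extremePoints hv, huv, rfl, hlev.trans h⟩)

theorem addedEdges_subset (hM : 0 < M) (hK : Convex ℝ (hypograph M g))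
    (hK' : Convex ℝ (hypograph M g'))
    (hcut : hypograph M g' = hypograph M g ∩ {q | ψ q ≤ s}) :
    addedEdges (removedEdges (skeleton M g).2
        {u | u ∈ (hypograph M g).extremePoints ℝ ∧ s < ψ u})
      {u | u ∈ (hypograph M g).extremePoints ℝ ∧ s < ψ u} {q | ψ q = s} ⊆
      (skeleton M g').2 := by
  have hadd := addedVertices_subset (s := s) (ψ := ψ) hM hK
  rw [← hcut] at hadd
  rintro e (⟨u₁, u₂, u₃, hu₁, ⟨he, u, hu, hseg⟩, hu₃, hne, rfl⟩ | ⟨u₂, u₃, ⟨he, -⟩, hu₃, rfl⟩)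
  · rcases (mem_skeleton_edges_iff hK).1 he with
      ⟨a, ha, b, hb, hab, hseg', hext⟩ | ⟨a, ha, hc, hray⟩
    swap
    · exact absurd hray (segment_ne_downRay _ _ _)
    have hus : u ∈ segment ℝ u₁ u₂ := by
      rcases hseg with ⟨w, h⟩ | h
      · rw [h]; exact right_mem_segment ℝ w u
      · exact absurd h (segment_ne_downRay _ _ _)
    -- An edge is only a set of points, so its ends have to be recovered: its vertices `a`, `b` are
    -- extreme and must be `u₁`, `u₂`. The removed end `u` is extreme as well and differs from `u₁`.
    have ha' := eq_or_eq_of_mem_segment ha hext.1 (hseg' ▸ left_mem_segment ℝ a b)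
    have hb' := eq_or_eq_of_mem_segment hb hext.1 (hseg' ▸ right_mem_segment ℝ a b)
    have hu₁K : u₁ ∈ (hypograph M g).extremePoints ℝ := by
      rcases ha' with rfl | rfl
      · exact ha
      · rcases hb' with rfl | rfl
        · exact hb
        · exact absurd rfl hab
    have hu₂u : u = u₂ := by
      rcases eq_or_eq_of_mem_segment hu.1 hext.1 hus with rfl | h
      · exact absurd hu hu₁
      · exact h
    subst hu₂u
    have hu₃m : u₃ ∈ segment ℝ u₁ u ∩ {q | ψ q = s} := hu₃ ▸ rfl
    have hle : ψ u₁ ≤ s := not_lt.1 fun h => hu₁ ⟨hu₁K, h⟩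
    have hlt : ψ u₁ < s := by
      refine lt_of_le_of_ne hle fun h => hne ?_
      have : u₁ ∈ segment ℝ u₁ u ∩ {q | ψ q = s} := ⟨left_mem_segment ℝ _ _, h⟩
      rw [hu₃] at this
      exact this.symm
    have hu₃V : u₃ ∈ (hypograph M g').extremePoints ℝ :=
      (hadd ⟨_, he, fun hsub => hu.2.ne' (hsub (right_mem_segment ℝ _ _)), hu₃m.2, hu₃m.1⟩).1
    refine (mem_skeleton_edges_iff hK').2 (Or.inl ⟨u₁, extremePoints_of_le hcut hu₁K hle, u₃, hu₃V,
      hne.symm, rfl, ?_⟩)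
    rw [← segment_inter_halfspace ψ hlt hu.2 hu₃m.1 hu₃m.2]
    refine ⟨?_, fun x hx y hy z hz hzxy => ?_⟩
    · rw [hcut]
      exact inter_subset_inter_left _ hext.1
    · rw [hcut] at hx hy
      exact ⟨hext.2 hx.1 hy.1 hz.1 hzxy, hx.2⟩
  · rcases (mem_skeleton_edges_iff hK).1 he with
      ⟨a, ha, b, hb, hab, hseg', hext⟩ | ⟨a, ha, hc, hray⟩
    · exact absurd hseg'.symm (segment_ne_downRay _ _ _)
    obtain rfl := downRay_injective hray
    have hu₃m : u₃ ∈ downRay u₂ ∩ {q | ψ q = s} := hu₃ ▸ rfl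
    refine (mem_skeleton_edges_iff hK').2 (Or.inr ⟨u₃, ?_, hu₃m.1.1 ▸ hc, rfl⟩)
    by_cases hu₂ : ψ u₂ = s
    · have : u₂ ∈ downRay u₂ ∩ {q | ψ q = s} := ⟨⟨rfl, le_rfl⟩, hu₂⟩
      rw [hu₃] at this
      obtain rfl : u₂ = u₃ := this
      exact extremePoints_of_le hcut ha hu₂.le
    · exact (hadd ⟨_, he, fun hsub => hu₂ (hsub ⟨rfl, le_rfl⟩), hu₃m.2, hu₃m.1⟩).1

theorem not_mem_removedEdges (hM : 0 < M) (hK' : Convex ℝ (hypograph M g'))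
    (hcut : hypograph M g' = hypograph M g ∩ {q | ψ q ≤ s})
    {e : Set ((Fin m → ℝ) × ℝ)} (he : e ∈ (skeleton M g').2) :
    e ∉ removedEdges (skeleton M g).2
      {u | u ∈ (hypograph M g).extremePoints ℝ ∧ s < ψ u} := by
  rintro ⟨-, u, hu, hue⟩
  have hmem : u ∈ e := by
    rcases hue with ⟨w, rfl⟩ | rfl
    · exact right_mem_segment ℝ w u
    · exact ⟨rfl, le_rfl⟩
  have := (isExtreme_of_mem_skeleton hM hK' he).1 hmem
  rw [hcut] at this
  exact not_lt.2 this.2 hu.2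

/-- The new vertical rays come from old vertical rays. -/
theorem downRay_cut_mem (hM : 0 < M) (hK : Convex ℝ (hypograph M g))
    (hcut : hypograph M g' = hypograph M g ∩ {q | ψ q ≤ s}) (hψ : ψ (0, 1) = 1)
    {u : (Fin m → ℝ) × ℝ} (hu : u ∈ (hypograph M g').extremePoints ℝ) (hc : u.1 ∈ corners m M) :
    downRay u ∈ (skeleton M g).2 ∨
      downRay u ∈ addedEdges (removedEdges (skeleton M g).2
        {u | u ∈ (hypograph M g).extremePoints ℝ ∧ s < ψ u})
        {u | u ∈ (hypograph M g).extremePoints ℝ ∧ s < ψ u} {q | ψ q = s} := by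
  have huK : u ∈ hypograph M g ∩ {q | ψ q ≤ s} := hcut ▸ hu.1
  have hv : (u.1, g u.1) ∈ (hypograph M g).extremePoints ℝ := mem_extremePoints_of_corner hc hM
  have hvE : downRay (u.1, g u.1) ∈ (skeleton M g).2 :=
    (mem_skeleton_edges_iff hK).2 (Or.inr ⟨_, hv, hc, rfl⟩)
  have hψz : ∀ z, ψ (u.1, z) = ψ u + (z - u.2) := by
    intro z
    have : (u.1, z) = u + (z - u.2) • (0, 1) := by ext <;> simp
    rw [this, map_add, map_smul, hψ, smul_eq_mul, mul_one]
  have htop : ∀ z, z ≤ g u.1 → ψ (u.1, z) ≤ s → z ≤ u.2 := by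
    intro z hz hzs
    have : (u.1, z) ∈ hypograph M g' := hcut ▸ ⟨⟨huK.1.1, hz⟩, hzs⟩
    rw [snd_eq_of_mem_extremePoints hu]
    exact this.2
  rcases le_or_gt (ψ (u.1, g u.1)) s with h | h
  · left
    have : u = (u.1, g u.1) := Prod.ext rfl (le_antisymm huK.1.2 (htop _ le_rfl h))
    rwa [← this] at hvE
  · right
    have hus : ψ u = s := by
      -- If `u` were below the hyperplane, it could be raised by the remaining slack and stay in the
      -- cut region.
      have h1 := htop (u.2 + (s - ψ u)) (by rw [hψz] at h; linarith)
        (by rw [hψz]; linarith)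
      have h2 : ψ u ≤ s := huK.2
      linarith
    refine Or.inr ⟨(u.1, g u.1), u, ⟨hvE, _, ⟨hv, h⟩, Or.inr rfl⟩, ?_, rfl⟩
    ext q
    constructor
    · rintro ⟨⟨h1 : q.1 = u.1, -⟩, h2 : ψ q = s⟩
      refine Prod.ext h1 ?_
      have := hψz q.2
      rw [← h1, Prod.mk.eta, h2, hus] at this
      linarith
    · rintro rfl
      exact ⟨⟨rfl, huK.1.2⟩, hus⟩

/-- A trimmed ray is again a ray, so a bounded new edge cannot come from a vertical one. -/
theorem downRay_inter_halfspace (hψ : ψ (0, 1) = 1) (p : (Fin m → ℝ) × ℝ) :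
    downRay p ∩ {q | ψ q ≤ s} = downRay (p.1, min p.2 (p.2 - (ψ p - s))) := by
  ext q
  have : q.1 = p.1 → ψ q = ψ p + (q.2 - p.2) := by
    intro h
    have : q = p + (q.2 - p.2) • (0, 1) := by ext <;> simp [h]
    conv_lhs => rw [this, map_add, map_smul, hψ, smul_eq_mul, mul_one]
  simp only [downRay, mem_inter_iff, mem_ofPred_eq, le_min_iff]
  constructor
  · rintro ⟨⟨h1, h2⟩, h3⟩
    rw [this h1] at h3
    exact ⟨h1, h2, by linarith⟩
  · rintro ⟨h1, h2, h3⟩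
    exact ⟨⟨h1, h2⟩, by rw [this h1]; linarith⟩

/-- The new bounded edges outside of the hyperplane come from old edges. -/
theorem segment_cut_mem [Finite ι] (hφ : hypograph M g = polyhedron φ c)
    (hcut : hypograph M g' = hypograph M g ∩ {q | ψ q ≤ s}) (hψ : ψ (0, 1) = 1)
    {a b : (Fin m → ℝ) × ℝ}
    (ha : a ∈ (hypograph M g').extremePoints ℝ) (hb : b ∈ (hypograph M g').extremePoints ℝ)
    (hab : a ≠ b) (hext : IsExtreme ℝ (hypograph M g') (segment ℝ a b))
    (hlev : ¬ (ψ a = s ∧ ψ b = s)) :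
    segment ℝ a b ∈ (skeleton M g).2 ∨
      segment ℝ a b ∈ addedEdges (removedEdges (skeleton M g).2
        {u | u ∈ (hypograph M g).extremePoints ℝ ∧ s < ψ u})
        {u | u ∈ (hypograph M g).extremePoints ℝ ∧ s < ψ u} {q | ψ q = s} := by
  have hK : Convex ℝ (hypograph M g) := hφ ▸ convex_polyhedron
  have haK : a ∈ hypograph M g ∩ {q | ψ q ≤ s} := hcut ▸ ha.1
  have hbK : b ∈ hypograph M g ∩ {q | ψ q ≤ s} := hcut ▸ hb.1
  have ha2 : ψ a ≤ s := haK.2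
  have hb2 : ψ b ≤ s := hbK.2
  -- The midpoint is strictly below the hyperplane, since the two ends are not both on it; its free
  -- directions are the same before and after the cut.
  set y := (1 / 2 : ℝ) • a + (1 / 2 : ℝ) • b with hy
  have hyo : y ∈ openSegment ℝ a b := ⟨1 / 2, 1 / 2, by norm_num, by norm_num, by norm_num, rfl⟩
  have hys : y ∈ segment ℝ a b := openSegment_subset_segment ℝ a b hyo
  have hyK : y ∈ hypograph M g := hK.segment_subset haK.1 hbK.1 hys
  have hψy : ψ y < s := by
    rw [hy, map_add, map_smul, map_smul, smul_eq_mul, smul_eq_mul]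
    rcases ha2.eq_or_lt with h | h
    · have := lt_of_le_of_ne hb2 fun h' => hlev ⟨h, h'⟩
      linarith
    · linarith
  have hfree : FreeDirection (hypograph M g) y (a - b) :=
    freeDirection_of_mem_openSegment hK haK.1 hbK.1 hyo
  have hya : a = y + (1 / 2 : ℝ) • (a - b) := by rw [hy]; module
  have hyb : b = y + (-(1 / 2) : ℝ) • (a - b) := by rw [hy]; module
  have hpar : ∀ q ∈ segment ℝ a b, ∃ t : ℝ, q = y + t • (a - b) := by
    rintro q hq
    rw [segment_eq_image'] at hq
    obtain ⟨θ, -, rfl⟩ := hq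
    exact ⟨1 / 2 - θ, by rw [hy]; module⟩
  have hline : ∀ d', FreeDirection (hypograph M g) y d' → ∃ t : ℝ, d' = t • (a - b) := by
    intro d' hd'
    have h1 := hd'.inter_halfspace hK hyK ψ hψy
    rw [← hcut] at h1
    obtain ⟨ε, hε, h2, -⟩ := h1.mem_extreme hext hys
    obtain ⟨t, ht⟩ := hpar _ h2
    refine ⟨t / ε, ?_⟩
    rw [add_right_inj] at ht
    rw [div_eq_inv_mul, mul_smul, ← ht, smul_smul, inv_mul_cancel₀ hε.ne', one_smul]
  have hG := line_mem_skeleton hφ hyK (sub_ne_zero.2 hab) hfree hline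
  set G := {q | q ∈ hypograph M g ∧ ∃ t : ℝ, q = y + t • (a - b)} with hGdef
  -- For the reverse inclusion, `y` lies strictly between a point of `G` other than `y` and one of
  -- `a`, `b`, so extremality of the segment captures that point.
  have heG : segment ℝ a b = G ∩ {q | ψ q ≤ s} := by
    ext q
    constructor
    · intro hq
      have hqK := hext.1 hq
      rw [hcut] at hqK
      exact ⟨⟨hqK.1, hpar q hq⟩, hqK.2⟩
    · rintro ⟨⟨hqK, t, rfl⟩, hqs⟩
      have hq' : y + t • (a - b) ∈ hypograph M g' := hcut ▸ ⟨hqK, hqs⟩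
      rcases le_total 0 t with ht | ht
      · rcases ht.eq_or_lt with rfl | ht
        · simpa using hys
        · refine hext.2 hq' hb.1 hys ?_
          nth_rw 2 [hyb]
          rw [neg_smul, ← sub_eq_add_neg]
          exact mem_openSegment_add_sub y (a - b) ht (by norm_num)
      · rcases ht.eq_or_lt with rfl | ht
        · simpa using hys
        · refine hext.right_mem_of_mem_openSegment ha.1 hq' hys ?_
          nth_rw 1 [hya]
          have := mem_openSegment_add_sub y (a - b) (one_half_pos (α := ℝ)) (neg_pos.2 ht)
          rwa [neg_smul, sub_neg_eq_add] at this
  rw [heG]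
  clear_value G
  have hyG : y ∈ G := (heG ▸ hys : y ∈ G ∩ {q | ψ q ≤ s}).1
  rcases (mem_skeleton_edges_iff hK).1 hG with ⟨p, hp, q, hq, hpq, rfl, hGext⟩ | ⟨p, hp, hc, rfl⟩
  -- If one end of the old edge is above the hyperplane, the other is strictly below it because `y`
  -- is; the statement is kept symmetric to serve either end.
  · have key : ∀ p q : (Fin m → ℝ) × ℝ, p ∈ (hypograph M g).extremePoints ℝ →
        q ∈ (hypograph M g).extremePoints ℝ → segment ℝ p q ∈ (skeleton M g).2 →
        y ∈ segment ℝ p q → s < ψ q → segment ℝ p q ∩ {q | ψ q ≤ s} ∈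
        addedEdges (removedEdges (skeleton M g).2
          {u | u ∈ (hypograph M g).extremePoints ℝ ∧ s < ψ u})
          {u | u ∈ (hypograph M g).extremePoints ℝ ∧ s < ψ u} {q | ψ q = s} := by
      intro p q hp hq hE hypq hqs
      have hps : ψ p < s := by
        by_contra! hps
        have := (convex_halfSpace_ge ψ.isLinear s).segment_subset hps hqs.le hypq
        exact not_lt.2 this hψy
      obtain ⟨u₃, hu₃⟩ := exists_segment_inter_level ψ hps hqs
      have hu₃m : u₃ ∈ segment ℝ p q ∩ {q | ψ q = s} := hu₃ ▸ rfl
      refine Or.inl ⟨p, q, u₃, fun h => not_lt.2 hps.le h.2,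
        ⟨hE, q, ⟨hq, hqs⟩, Or.inl ⟨p, rfl⟩⟩, hu₃, ?_,
        segment_inter_halfspace ψ hps hqs hu₃m.1 hu₃m.2⟩
      rintro rfl
      exact hps.ne hu₃m.2
    rcases le_or_gt (ψ q) s with hqs | hqs
    · rcases le_or_gt (ψ p) s with hps | hps
      · left
        rwa [inter_eq_left.2 ((convex_halfSpace_le ψ.isLinear s).segment_subset hps hqs)]
      · right
        rw [segment_symm] at hG hyG ⊢
        exact key q p hq hp hG hyG hps
    · exact Or.inr (key p q hp hq hG hyG hqs)
  · exact absurd (heG.trans (downRay_inter_halfspace hψ p)) (segment_ne_downRay _ _ _)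

/-- A new bounded edge with both ends on the hyperplane is an edge of the slice; every other new
edge comes from an old one. None contains a point above the hyperplane, so discarding `E⁻` last
loses nothing. -/
theorem skeleton_edges_cut [Finite ι] (hM : 0 < M) (hφ : hypograph M g = polyhedron φ c)
    (hcut : hypograph M g' = hypograph M g ∩ {q | ψ q ≤ s}) (hψ : ψ (0, 1) = 1)
    (hne : ∃ y ∈ hypograph M g, ψ y ≠ s) :
    (skeleton M g').2 =
      ((skeleton M g).2 ∪ convEdge (addedVertices (skeleton M g).2 {q | ψ q = s}) ∪
        addedEdges (removedEdges (skeleton M g).2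
          {u | u ∈ vertices (hypograph M g) ∧ s < ψ u})
          {u | u ∈ vertices (hypograph M g) ∧ s < ψ u} {q | ψ q = s}) \
        removedEdges (skeleton M g).2 {u | u ∈ vertices (hypograph M g) ∧ s < ψ u} := by
  have hK : Convex ℝ (hypograph M g) := hφ ▸ convex_polyhedron
  have hK' : Convex ℝ (hypograph M g') :=
    hcut ▸ hK.inter (convex_halfSpace_le ψ.isLinear s)
  rw [vertices_eq_extremePoints hK, convEdge, addedVertices_eq hM hφ hne,
    convexHull_extremePoints_level hφ hψ]
  ext e
  constructor
  · intro he
    refine ⟨?_, not_mem_removedEdges hM hK' hcut he⟩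
    rcases (mem_skeleton_edges_iff hK').1 he with ⟨a, ha, b, hb, hab, rfl, h⟩ | ⟨u, hu, hc, rfl⟩
    · by_cases hlev : ψ a = s ∧ ψ b = s
      · have hext := isExtreme_level hcut
        have haK : a ∈ hypograph M g ∩ {q | ψ q ≤ s} := hcut ▸ ha.1
        have hbK : b ∈ hypograph M g ∩ {q | ψ q ≤ s} := hcut ▸ hb.1
        refine Or.inl (Or.inr ((mem_boundedEdges_iff (convex_level hK)).2
          ⟨a, ?_, b, ?_, hab, rfl, h.mono hext.1
            ((convex_level hK).segment_subset ⟨haK.1, hlev.1⟩ ⟨hbK.1, hlev.2⟩)⟩))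
        · rw [hext.extremePoints_eq]
          exact ⟨⟨haK.1, hlev.1⟩, ha⟩
        · rw [hext.extremePoints_eq]
          exact ⟨⟨hbK.1, hlev.2⟩, hb⟩
      · rcases segment_cut_mem hφ hcut hψ ha hb hab h hlev with h | h
        · exact Or.inl (Or.inl h)
        · exact Or.inr h
    · rcases downRay_cut_mem hM hK hcut hψ hu hc with h | h
      · exact Or.inl (Or.inl h)
      · exact Or.inr h
  · rintro ⟨(he | he) | he, hn⟩
    · exact mem_skeleton_cut_of_not_mem_removedEdges hK hK' hcut he hn
    · exact boundedEdges_level_subset hK hK' hcut he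
    · exact addedEdges_subset hM hK hK' hcut he

end DualSearch

/-! ### The induced dual as a polyhedron, and induction along the run -/

namespace DualSearch

open Set

variable {n m : ℕ}

theorem le_inducedDual_iff (L : (Fin n → Bool) → (Fin m → ℝ) → ℝ) {X : Set (Fin n → Bool)}
    (hX : X.Nonempty) (lam : Fin m → ℝ) (z : ℝ) :
    z ≤ inducedDual L X lam ↔ ∀ x ∈ X, z ≤ L x lam := by
  rw [le_isGLB_iff (inducedDual_isLeast L hX lam).isGLB]
  simp [mem_lowerBounds]

/-- The linear functional `(lam, z) ↦ z - lam ⬝ a`. -/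
def heightAbove (a : Fin m → ℝ) : (Fin m → ℝ) × ℝ →ₗ[ℝ] ℝ :=
  LinearMap.snd ℝ _ _ - ∑ i, a i • (LinearMap.proj i ∘ₗ LinearMap.fst ℝ (Fin m → ℝ) ℝ)

theorem heightAbove_apply (a : Fin m → ℝ) (q : (Fin m → ℝ) × ℝ) :
    heightAbove a q = q.2 - ∑ i, q.1 i * a i := by
  simp [heightAbove, mul_comm]

variable (f : (Fin n → Bool) → ℝ) (H : (Fin n → Bool) → Fin m → ℝ) (b : Fin m → ℝ) {M : ℝ}

theorem le_lagrangian_iff (x : Fin n → Bool) (q : (Fin m → ℝ) × ℝ) :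
    q.2 ≤ lagrangian f H b x q.1 ↔ heightAbove (H x - b) q ≤ f x := by
  simp [heightAbove_apply, lagrangian]

/-- Being below a minimum means being below every `L(x, ·)`, one affine constraint each; the box
adds `lam i ≤ M` and `-lam i ≤ M`. -/
theorem hypograph_inducedDual_eq_polyhedron {X : Set (Fin n → Bool)} (hX : X.Nonempty) :
    hypograph M (inducedDual (lagrangian f H b) X) =
      polyhedron (Sum.elim
        (fun p : Fin m × Bool => (if p.2 then (1 : ℝ) else -1) •
          (LinearMap.proj p.1 ∘ₗ LinearMap.fst ℝ (Fin m → ℝ) ℝ))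
        fun x : X => heightAbove (H x - b)) (Sum.elim (fun _ => M) fun x : X => f x) := by
  ext q
  simp only [hypograph, polyhedron, mem_ofPred_eq, le_inducedDual_iff _ hX, Sum.forall,
    Sum.elim_inl, Sum.elim_inr, Prod.forall, Bool.forall_bool, Subtype.forall,
    le_lagrangian_iff f H b]
  refine and_congr_left fun _ => forall_congr' fun i => ?_
  simp [neg_le]

theorem hypograph_inducedDual_union {X : Set (Fin n → Bool)} (hX : X.Nonempty)
    (x : Fin n → Bool) :
    hypograph M (inducedDual (lagrangian f H b) (X ∪ {x})) =
      hypograph M (inducedDual (lagrangian f H b) X) ∩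
        {q | heightAbove (H x - b) q ≤ f x} := by
  ext q
  simp only [hypograph, mem_inter_iff, mem_ofPred_eq, le_inducedDual_iff _ hX,
    le_inducedDual_iff _ (hX.mono subset_union_left), ← le_lagrangian_iff, mem_union,
    mem_singleton_iff, or_imp, forall_and, forall_eq, and_assoc]

theorem inducedDual_singleton (L : (Fin n → Bool) → (Fin m → ℝ) → ℝ) (x : Fin n → Bool) :
    inducedDual L {x} = L x := by
  ext lam
  simpa [eq_comm] using (inducedDual_isLeast L (singleton_nonempty x) lam).1

/-- The vertices of the region below a single hyperplane lie over the corners of the box. -/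
theorem vertices_hypograph_lagrangian (hM : 0 < M) (x : Fin n → Bool) :
    vertices (hypograph M (lagrangian f H b x)) =
      {v | v.1 ∈ corners m M ∧ v.2 = lagrangian f H b x v.1} := by
  have hφ := hypograph_inducedDual_eq_polyhedron f H b (M := M) (singleton_nonempty x)
  rw [inducedDual_singleton] at hφ
  have hK : Convex ℝ (hypograph M (lagrangian f H b x)) := hφ ▸ convex_polyhedron
  rw [vertices_eq_extremePoints hK]
  ext v
  constructor
  · intro hv
    have htop := snd_eq_of_mem_extremePoints hv
    refine ⟨fun i => ?_, htop⟩
    by_contra! hi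
    have h1 : -M < v.1 i := lt_of_le_of_ne (hv.1.1 i).1 hi.1.symm
    have h2 : v.1 i < M := lt_of_le_of_ne (hv.1.1 i).2 hi.2
    have hvK := hv.1
    -- Coordinate `i` can move both ways inside the box, following the slope of the hyperplane so
    -- that its constraint stays tight.
    have hfree : FreeDirection (hypograph M (lagrangian f H b x)) v
        (Pi.single i 1, H x i - b i) := by
      rw [hφ] at hvK ⊢
      rw [freeDirection_polyhedron hvK]
      rintro (⟨j, σ⟩ | ⟨y, hy⟩) h
      · rcases eq_or_ne j i with rfl | hj
        · exfalso
          cases σ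
          · simp at h; linarith
          · simp at h; linarith
        · cases σ <;> simp [hj]
      · obtain rfl : y = x := hy
        simp [heightAbove_apply, Pi.single_apply]
    have := ((mem_extremePoints_iff_freeDirection hK).1 hv).2 _ hfree
    have := congrFun (congrArg Prod.fst this) i
    simp at this
  · rintro ⟨hc, hv⟩
    have : v = (v.1, lagrangian f H b x v.1) := Prod.ext rfl hv
    rw [this]
    exact mem_extremePoints_of_corner hc hM

theorem skeleton_initState (hM : 0 < M) (x : Fin n → Bool) :
    ((initState (lagrangian f H b) M x).V, (initState (lagrangian f H b) M x).E) =
      skeleton M (inducedDual (lagrangian f H b) {x}) := by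
  refine Prod.ext ?_ rfl
  show _ = vertices (hypograph M (inducedDual (lagrangian f H b) {x}))
  rw [inducedDual_singleton, vertices_hypograph_lagrangian f H b hM]
  rfl

/-- Cutting off a vertex turns the skeleton of `g_X` into that of `g_{X ∪ {x}}`. -/
theorem skeleton_cut (hM : 0 < M) {s : State n m} (hX : s.X.Nonempty)
    (hs : (s.V, s.E) = skeleton M (inducedDual (lagrangian f H b) s.X))
    {v : (Fin m → ℝ) × ℝ} (hv : v ∈ s.V) {x : Fin n → Bool}
    (hx : lagrangian f H b x v.1 < v.2) :
    ((cut (lagrangian f H b) s x).V, (cut (lagrangian f H b) s x).E) =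
      skeleton M (inducedDual (lagrangian f H b) (s.X ∪ {x})) := by
  have hφ := hypograph_inducedDual_eq_polyhedron f H b (M := M) hX
  have hcut := hypograph_inducedDual_union f H b (M := M) hX x
  have hψ : heightAbove (H x - b) (0, 1) = 1 := by simp [heightAbove_apply]
  have hV : s.V = vertices (hypograph M (inducedDual (lagrangian f H b) s.X)) :=
    congrArg Prod.fst hs
  have hE : s.E = (skeleton M (inducedDual (lagrangian f H b) s.X)).2 := congrArg Prod.snd hs
  have hP : hyperplane (lagrangian f H b) x = {q | heightAbove (H x - b) q = f x} := by
    ext q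
    simp only [hyperplane, mem_ofPred_eq, heightAbove_apply, lagrangian, Pi.sub_apply,
      sub_eq_iff_eq_add]
  have hlt : ∀ u : (Fin m → ℝ) × ℝ,
      lagrangian f H b x u.1 < u.2 ↔ f x < heightAbove (H x - b) u := by
    intro u
    rw [← not_le, ← not_le, le_lagrangian_iff]
  -- The chosen vertex is strictly above the new hyperplane, so the old region is not contained in
  -- it.
  have hne : ∃ y ∈ hypograph M (inducedDual (lagrangian f H b) s.X),
      heightAbove (H x - b) y ≠ f x := by
    rw [hV] at hv
    exact ⟨v, hv.1, ((hlt v).1 hx).ne'⟩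
  refine Prod.ext ?_ ?_
  · show _ = vertices (hypograph M (inducedDual (lagrangian f H b) (s.X ∪ {x})))
    rw [vertices_cut hM hφ hcut]
    simp only [cut, removedVertices, hP, hlt, hV, hE]
  · rw [skeleton_edges_cut hM hφ hcut hψ hne]
    simp only [cut, removedVertices, hP, hlt, hV, hE]

/-- Nonemptiness of `X` is part of the invariant because `inducedDual` is a minimum only then. -/
theorem ReachedAfter.skeleton_eq (hM : 0 < M) {t : ℕ} {s : State n m}
    (hs : ReachedAfter (lagrangian f H b) M t s) :
    s.X.Nonempty ∧ (s.V, s.E) = skeleton M (inducedDual (lagrangian f H b) s.X) := by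
  induction hs with
  | init lam₀ hlam₀ x₀ hx₀ => exact ⟨singleton_nonempty x₀, skeleton_initState f H b hM x₀⟩
  | step t s hs v hv hv' x hx ih =>
    by_cases h : lagrangian f H b x v.1 < v.2
    · simp only [iterate, if_pos h]
      exact ⟨ih.1.mono subset_union_left, skeleton_cut f H b hM ih.1 ih.2 hv h⟩
    · simpa only [iterate, if_neg h] using ih

end DualSearch

theorem mainTheorem3 (n m : ℕ) (f : (Fin n → Bool) → ℝ) (H : (Fin n → Bool) → Fin m → ℝ)
    (b : Fin m → ℝ) (M : ℝ) (hM : 0 < M) (t : ℕ) (s : DualSearch.State n m)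
    (hs : DualSearch.ReachedAfter (DualSearch.lagrangian f H b) M t s) :
    (s.V, s.E) =
      DualSearch.skeleton M (DualSearch.inducedDual (DualSearch.lagrangian f H b) s.X) :=
  (hs.skeleton_eq f H b hM).2
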